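/- Let $n$ be a natural number and let $\boldsymbol U_v(\mathfrak q_n)$ be the quantum queer superalgebra over $\mathbb Q(v)$: the associative algebra generated by even elements $K_i^{\pm1}$, $E_a$, $F_a$ and odd elements $\bar K_i$, $\bar E_a$, $\bar F_a$ ($1\le i\le n$, $1\le a\le n-1$), subject to the following relations (whenever all indices are in range, $\delta$ is the Kronecker delta, and $(\epsilon_i,\alpha_a)=\delta_{i,a}-\delta_{i,a+1}$). (1) $K_iK_i^{-1}=K_i^{-1}K_i=1$, $K_iK_j=K_jK_i$, $K_i\bar K_j=\bar K_jK_i$, $\bar K_i\bar K_j+\bar K_j\bar K_i=2\delta_{i,j}\frac{K_i^2-K_i^{-2}}{v^2-v^{-2}}$. (2) $K_iX_a=v^{(\epsilon_i,\alpha_a)}X_aK_i$ for $X=E,\bar E$, and $K_iX_a=v^{-(\epsilon_i,\alpha_a)}X_aK_i$ for $X=F,\bar F$. (3) $\bar K_iE_i-vE_i\bar K_i=\bar E_iK_i^{-1}$, $v\bar K_iE_{i-1}-E_{i-1}\bar K_i=-K_i^{-1}\bar E_{i-1}$, $\bar K_iF_i-vF_i\bar K_i=-\bar F_iK_i$, $v\bar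 K_iF_{i-1}-F_{i-1}\bar K_i=K_i\bar F_{i-1}$, $\bar K_i\bar E_i+v\bar E_i\bar K_i=E_iK_i^{-1}$, $v\bar K_i\bar E_{i-1}+\bar E_{i-1}\bar K_i=K_i^{-1}E_{i-1}$, $\bar K_i\bar F_i+v\bar F_i\bar K_i=F_iK_i$, $v\bar K_i\bar F_{i-1}+\bar F_{i-1}\bar K_i=K_iF_{i-1}$; and for $a\ne i,i-1$, $\bar K_i$ commutes with $E_a,F_a$ and anticommutes with $\bar E_a,\bar F_a$. (4) $E_aF_b-F_bE_a=\delta_{a,b}\frac{K_aK_{a+1}^{-1}-K_a^{-1}K_{a+1}}{v-v^{-1}}$, $\bar E_a\bar F_b+\bar F_b\bar E_a=\delta_{a,b}\Big(\frac{K_aK_{a+1}-K_a^{-1}K_{a+1}^{-1}}{v-v^{-1}}+(v-v^{-1})\bar K_a\bar K_{a+1}\Big)$, $E_a\bar F_b-\bar F_bE_a=\delta_{a,b}(K_{a+1}^{-1}\bar K_a-\bar K_{a+1}K_a^{-1})$, $\bar E_aF_b-F_b\bar E_a=\delta_{a,b}(K_{a+1}\bar K_a-\bar K_{a+1}K_a)$.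 (5) $\bar E_a^2=-\frac{v-v^{-1}}{v+v^{-1}}E_a^2$, $\bar F_a^2=\frac{v-v^{-1}}{v+v^{-1}}F_a^2$; $E_a\bar E_b=\bar E_bE_a$ and $F_a\bar F_b=\bar F_bF_a$ for $|a-b|\neq1$; $E_aE_b=E_bE_a$, $F_aF_b=F_bF_a$, $\bar E_a\bar E_b=-\bar E_b\bar E_a$, $\bar F_a\bar F_b=-\bar F_b\bar F_a$ for $|a-b|>1$; $E_aE_{a+1}-vE_{a+1}E_a=\bar E_a\bar E_{a+1}+v\bar E_{a+1}\bar E_a$, $E_a\bar E_{a+1}-v\bar E_{a+1}E_a=\bar E_aE_{a+1}-vE_{a+1}\bar E_a$, $F_aF_{a+1}-vF_{a+1}F_a=-(\bar F_a\bar F_{a+1}+v\bar F_{a+1}\bar F_a)$, $F_a\bar F_{a+1}-v\bar F_{a+1}F_a=\bar F_aF_{a+1}-vF_{a+1}\bar F_a$. (6) For $|a-b|=1$: $X_a^2Y_b-(v+v^{-1})X_aY_bX_a+Y_bX_a^2=0$ for $(X,Y)=(E,E),(F,F),(E,\bar E),(F,\bar F)$. Define the root vectors as follows: $E_{a,a+1}=E_a$,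 $\bar E_{a,a+1}=\bar E_a$, $E_{a+1,a}=F_a$, $\bar E_{a+1,a}=\bar F_a$, and for $1\le a$, $a+1<b\le n$, $$E_{a,b}=-E_{a,b-1}E_{b-1}+v^{-1}E_{b-1}E_{a,b-1},\qquad \bar E_{a,b}=-E_{a,b-1}\bar E_{b-1}+v^{-1}\bar E_{b-1}E_{a,b-1},$$ $$E_{b,a}=-F_{b-1}E_{b-1,a}+vE_{b-1,a}F_{b-1},\qquad \bar E_{b,a}=-\bar F_{b-1}E_{b-1,a}+vE_{b-1,a}\bar F_{b-1}.$$ **Lemma.** Let $1\le i,j,k,l\le n$ with $i<j$, $k<l$ and $i\le k$. Then $\bar E_{j,i}\bar E_{k,l}$ is equal to - $-\bar E_{k,l}\bar E_{j,i}$, if $i<j\le k<l$ or $i<k<l<j$; - $-\bar E_{k,l}\bar E_{j,i}-\bar K_j\bar E_{j,l}K_i^{-1}-v^{-1}\bar E_{j,l}\bar K_jK_i^{-1}$, if $i=k<j<l$; - $-\bar E_{k,l}\bar E_{j,i}-\bar E_{j,l}\bar K_lK_i-v\bar K_l\bar E_{j,l}K_i$, if $i=k<l<j$; - $-\bar E_{k,l}\bar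 E_{j,i}-E_{k,i}K_k^{-1}K_j^{-1}-(v-v^{-1})(E_{j,i}\bar E_{k,j}-\bar E_{k,j}E_{j,i})K_j^{-1}\bar K_j$, if $i<k<j=l$; - $-\bar E_{k,l}\bar E_{j,i}-(v-v^{-1})\bar K_j\bar E_{j,l}E_{k,i}K_k^{-1}-v^{-1}(v-v^{-1})E_{k,i}\bar E_{j,l}\bar K_jK_k^{-1}$, if $i<k<j<l$; - $-\bar E_{k,l}\bar E_{j,i}+\frac{K_jK_i-K_i^{-1}K_j^{-1}}{v-v^{-1}}+(v-v^{-1})\bar K_j^2K_i^{-1}K_j-(v-v^{-1})(\bar E_{j,i}E_{i,j}-E_{i,j}\bar E_{j,i})K_j\bar K_j$, if $i=k$ and $j=l$. -/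

import Mathlib

noncomputable section

namespace QuantumQueer

/-- The field `ℚ(v)` of rational functions in one variable over `ℚ`. -/
abbrev Qv : Type := RatFunc ℚ

/-- The indeterminate `v` of `ℚ(v)`. -/
def v : Qv := RatFunc.X

/-- The generators: `K i`, `Kinv i` and `Kbar i` for `1 ≤ i ≤ n`, and `E j`, `F j`, `Ebar j`,
`Fbar j` for `1 ≤ j ≤ n - 1`. The barred generators are odd, the others are even. -/
inductive Gen (n : ℕ) : Type
  | K (i : Set.Icc 1 n) : Gen n
  | Kinv (i : Set.Icc 1 n) : Gen n
  | Kbar (i : Set.Icc 1 n) : Gen n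
  | E (j : Set.Ico 1 n) : Gen n
  | F (j : Set.Ico 1 n) : Gen n
  | Ebar (j : Set.Ico 1 n) : Gen n
  | Fbar (j : Set.Ico 1 n) : Gen n

/-- The free algebra over `ℚ(v)` on the generators. -/
abbrev Free (n : ℕ) : Type := FreeAlgebra Qv (Gen n)

/-! Generators in the free algebra, indexed by natural numbers; the value at an index that is out
of range is `0` and is never used. -/

namespace Free

def K (n i : ℕ) : Free n := if h : i ∈ Set.Icc 1 n then FreeAlgebra.ι Qv (Gen.K ⟨i, h⟩) else 0
def Kinv (n i : ℕ) : Free n :=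
  if h : i ∈ Set.Icc 1 n then FreeAlgebra.ι Qv (Gen.Kinv ⟨i, h⟩) else 0
def Kbar (n i : ℕ) : Free n :=
  if h : i ∈ Set.Icc 1 n then FreeAlgebra.ι Qv (Gen.Kbar ⟨i, h⟩) else 0
def E (n j : ℕ) : Free n := if h : j ∈ Set.Ico 1 n then FreeAlgebra.ι Qv (Gen.E ⟨j, h⟩) else 0
def F (n j : ℕ) : Free n := if h : j ∈ Set.Ico 1 n then FreeAlgebra.ι Qv (Gen.F ⟨j, h⟩) else 0
def Ebar (n j : ℕ) : Free n :=
  if h : j ∈ Set.Ico 1 n then FreeAlgebra.ι Qv (Gen.Ebar ⟨j, h⟩) else 0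
def Fbar (n j : ℕ) : Free n :=
  if h : j ∈ Set.Ico 1 n then FreeAlgebra.ι Qv (Gen.Fbar ⟨j, h⟩) else 0

end Free

/-- The pairing `(ε_i, α_j)`, where `α_j = ε_j - ε_{j+1}` and the `ε_i` are orthonormal. -/
def pairing (i j : ℕ) : ℤ := (if i = j then 1 else 0) - (if i = j + 1 then 1 else 0)

open Free in
/-- The defining relations. Indices of `K`, `Kinv`, `Kbar` run over `1, …, n`, those of
`E`, `F`, `Ebar`, `Fbar` over `1, …, n - 1`. -/
inductive Rel (n : ℕ) : Free n → Free n → Prop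
  -- relations among the `K`s
  | K_Kinv (i : ℕ) (hi : i ∈ Set.Icc 1 n) : Rel n (K n i * Kinv n i) 1
  | Kinv_K (i : ℕ) (hi : i ∈ Set.Icc 1 n) : Rel n (Kinv n i * K n i) 1
  | K_K (i j : ℕ) (hi : i ∈ Set.Icc 1 n) (hj : j ∈ Set.Icc 1 n) :
      Rel n (K n i * K n j) (K n j * K n i)
  | K_Kbar (i j : ℕ) (hi : i ∈ Set.Icc 1 n) (hj : j ∈ Set.Icc 1 n) :
      Rel n (K n i * Kbar n j) (Kbar n j * K n i)
  | Kbar_Kbar (i j : ℕ) (hi : i ∈ Set.Icc 1 n) (hj : j ∈ Set.Icc 1 n) :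
      Rel n (Kbar n i * Kbar n j + Kbar n j * Kbar n i)
        (if i = j then (2 / (v ^ 2 - (v⁻¹) ^ 2)) • (K n i ^ 2 - Kinv n i ^ 2) else 0)
  -- the weight relations
  | K_E (i j : ℕ) (hi : i ∈ Set.Icc 1 n) (hj : j ∈ Set.Ico 1 n) :
      Rel n (K n i * E n j) ((v ^ pairing i j) • (E n j * K n i))
  | K_Ebar (i j : ℕ) (hi : i ∈ Set.Icc 1 n) (hj : j ∈ Set.Ico 1 n) :
      Rel n (K n i * Ebar n j) ((v ^ pairing i j) • (Ebar n j * K n i))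
  | K_F (i j : ℕ) (hi : i ∈ Set.Icc 1 n) (hj : j ∈ Set.Ico 1 n) :
      Rel n (K n i * F n j) ((v ^ (-pairing i j)) • (F n j * K n i))
  | K_Fbar (i j : ℕ) (hi : i ∈ Set.Icc 1 n) (hj : j ∈ Set.Ico 1 n) :
      Rel n (K n i * Fbar n j) ((v ^ (-pairing i j)) • (Fbar n j * K n i))
  -- `Kbar i` against `E`, `F`, `Ebar`, `Fbar` with index `i` or `i - 1` (written `i = j + 1`)
  | Kbar_E_same (i : ℕ) (hi : i ∈ Set.Ico 1 n) :
      Rel n (Kbar n i * E n i - v • (E n i * Kbar n i)) (Ebar n i * Kinv n i)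
  | Kbar_E_pred (j : ℕ) (hj : j ∈ Set.Ico 1 n) :
      Rel n (v • (Kbar n (j + 1) * E n j) - E n j * Kbar n (j + 1))
        (-(Kinv n (j + 1) * Ebar n j))
  | Kbar_F_same (i : ℕ) (hi : i ∈ Set.Ico 1 n) :
      Rel n (Kbar n i * F n i - v • (F n i * Kbar n i)) (-(Fbar n i * K n i))
  | Kbar_F_pred (j : ℕ) (hj : j ∈ Set.Ico 1 n) :
      Rel n (v • (Kbar n (j + 1) * F n j) - F n j * Kbar n (j + 1)) (K n (j + 1) * Fbar n j)
  | Kbar_Ebar_same (i : ℕ) (hi : i ∈ Set.Ico 1 n) :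
      Rel n (Kbar n i * Ebar n i + v • (Ebar n i * Kbar n i)) (E n i * Kinv n i)
  | Kbar_Ebar_pred (j : ℕ) (hj : j ∈ Set.Ico 1 n) :
      Rel n (v • (Kbar n (j + 1) * Ebar n j) + Ebar n j * Kbar n (j + 1))
        (Kinv n (j + 1) * E n j)
  | Kbar_Fbar_same (i : ℕ) (hi : i ∈ Set.Ico 1 n) :
      Rel n (Kbar n i * Fbar n i + v • (Fbar n i * Kbar n i)) (F n i * K n i)
  | Kbar_Fbar_pred (j : ℕ) (hj : j ∈ Set.Ico 1 n) :
      Rel n (v • (Kbar n (j + 1) * Fbar n j) + Fbar n j * Kbar n (j + 1)) (K n (j + 1) * F n j)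
  | Kbar_E_far (i j : ℕ) (hi : i ∈ Set.Icc 1 n) (hj : j ∈ Set.Ico 1 n) (h : i ≠ j)
      (h' : i ≠ j + 1) : Rel n (Kbar n i * E n j - E n j * Kbar n i) 0
  | Kbar_F_far (i j : ℕ) (hi : i ∈ Set.Icc 1 n) (hj : j ∈ Set.Ico 1 n) (h : i ≠ j)
      (h' : i ≠ j + 1) : Rel n (Kbar n i * F n j - F n j * Kbar n i) 0
  | Kbar_Ebar_far (i j : ℕ) (hi : i ∈ Set.Icc 1 n) (hj : j ∈ Set.Ico 1 n) (h : i ≠ j)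
      (h' : i ≠ j + 1) : Rel n (Kbar n i * Ebar n j + Ebar n j * Kbar n i) 0
  | Kbar_Fbar_far (i j : ℕ) (hi : i ∈ Set.Icc 1 n) (hj : j ∈ Set.Ico 1 n) (h : i ≠ j)
      (h' : i ≠ j + 1) : Rel n (Kbar n i * Fbar n j + Fbar n j * Kbar n i) 0
  -- `E`, `Ebar` against `F`, `Fbar`
  | E_F (i j : ℕ) (hi : i ∈ Set.Ico 1 n) (hj : j ∈ Set.Ico 1 n) :
      Rel n (E n i * F n j - F n j * E n i)
        (if i = j then
          (v - v⁻¹)⁻¹ • (K n i * Kinv n (i + 1) - Kinv n i * K n (i + 1)) else 0)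
  | Ebar_Fbar (i j : ℕ) (hi : i ∈ Set.Ico 1 n) (hj : j ∈ Set.Ico 1 n) :
      Rel n (Ebar n i * Fbar n j + Fbar n j * Ebar n i)
        (if i = j then
          (v - v⁻¹)⁻¹ • (K n i * K n (i + 1) - Kinv n i * Kinv n (i + 1))
            + (v - v⁻¹) • (Kbar n i * Kbar n (i + 1)) else 0)
  | E_Fbar (i j : ℕ) (hi : i ∈ Set.Ico 1 n) (hj : j ∈ Set.Ico 1 n) :
      Rel n (E n i * Fbar n j - Fbar n j * E n i)
        (if i = j then Kinv n (i + 1) * Kbar n i - Kbar n (i + 1) * Kinv n i else 0)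
  | Ebar_F (i j : ℕ) (hi : i ∈ Set.Ico 1 n) (hj : j ∈ Set.Ico 1 n) :
      Rel n (Ebar n i * F n j - F n j * Ebar n i)
        (if i = j then K n (i + 1) * Kbar n i - Kbar n (i + 1) * K n i else 0)
  -- quadratic relations among the `E`, `Ebar`, and among the `F`, `Fbar`
  | Ebar_sq (i : ℕ) (hi : i ∈ Set.Ico 1 n) :
      Rel n (Ebar n i ^ 2) (-((v - v⁻¹) / (v + v⁻¹)) • E n i ^ 2)
  | Fbar_sq (i : ℕ) (hi : i ∈ Set.Ico 1 n) :
      Rel n (Fbar n i ^ 2) (((v - v⁻¹) / (v + v⁻¹)) • F n i ^ 2)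
  | E_Ebar_comm (i j : ℕ) (hi : i ∈ Set.Ico 1 n) (hj : j ∈ Set.Ico 1 n) (h : i ≠ j + 1)
      (h' : j ≠ i + 1) : Rel n (E n i * Ebar n j - Ebar n j * E n i) 0
  | F_Fbar_comm (i j : ℕ) (hi : i ∈ Set.Ico 1 n) (hj : j ∈ Set.Ico 1 n) (h : i ≠ j + 1)
      (h' : j ≠ i + 1) : Rel n (F n i * Fbar n j - Fbar n j * F n i) 0
  | E_E_far (i j : ℕ) (hi : i ∈ Set.Ico 1 n) (hj : j ∈ Set.Ico 1 n)
      (h : i + 1 < j ∨ j + 1 < i) : Rel n (E n i * E n j - E n j * E n i) 0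
  | F_F_far (i j : ℕ) (hi : i ∈ Set.Ico 1 n) (hj : j ∈ Set.Ico 1 n)
      (h : i + 1 < j ∨ j + 1 < i) : Rel n (F n i * F n j - F n j * F n i) 0
  | Ebar_Ebar_far (i j : ℕ) (hi : i ∈ Set.Ico 1 n) (hj : j ∈ Set.Ico 1 n)
      (h : i + 1 < j ∨ j + 1 < i) : Rel n (Ebar n i * Ebar n j + Ebar n j * Ebar n i) 0
  | Fbar_Fbar_far (i j : ℕ) (hi : i ∈ Set.Ico 1 n) (hj : j ∈ Set.Ico 1 n)
      (h : i + 1 < j ∨ j + 1 < i) : Rel n (Fbar n i * Fbar n j + Fbar n j * Fbar n i) 0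
  | E_E_succ (i : ℕ) (hi : i ∈ Set.Ico 1 n) (hi' : i + 1 ∈ Set.Ico 1 n) :
      Rel n (E n i * E n (i + 1) - v • (E n (i + 1) * E n i))
        (Ebar n i * Ebar n (i + 1) + v • (Ebar n (i + 1) * Ebar n i))
  | E_Ebar_succ (i : ℕ) (hi : i ∈ Set.Ico 1 n) (hi' : i + 1 ∈ Set.Ico 1 n) :
      Rel n (E n i * Ebar n (i + 1) - v • (Ebar n (i + 1) * E n i))
        (Ebar n i * E n (i + 1) - v • (E n (i + 1) * Ebar n i))
  | F_F_succ (i : ℕ) (hi : i ∈ Set.Ico 1 n) (hi' : i + 1 ∈ Set.Ico 1 n) :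
      Rel n (F n i * F n (i + 1) - v • (F n (i + 1) * F n i))
        (-(Fbar n i * Fbar n (i + 1) + v • (Fbar n (i + 1) * Fbar n i)))
  | F_Fbar_succ (i : ℕ) (hi : i ∈ Set.Ico 1 n) (hi' : i + 1 ∈ Set.Ico 1 n) :
      Rel n (F n i * Fbar n (i + 1) - v • (Fbar n (i + 1) * F n i))
        (Fbar n i * F n (i + 1) - v • (F n (i + 1) * Fbar n i))
  -- the cubic Serre relations, for `|i - j| = 1`
  | serre_E (i j : ℕ) (hi : i ∈ Set.Ico 1 n) (hj : j ∈ Set.Ico 1 n)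
      (h : i = j + 1 ∨ j = i + 1) :
      Rel n (E n i ^ 2 * E n j - (v + v⁻¹) • (E n i * E n j * E n i) + E n j * E n i ^ 2) 0
  | serre_F (i j : ℕ) (hi : i ∈ Set.Ico 1 n) (hj : j ∈ Set.Ico 1 n)
      (h : i = j + 1 ∨ j = i + 1) :
      Rel n (F n i ^ 2 * F n j - (v + v⁻¹) • (F n i * F n j * F n i) + F n j * F n i ^ 2) 0
  | serre_Ebar (i j : ℕ) (hi : i ∈ Set.Ico 1 n) (hj : j ∈ Set.Ico 1 n)
      (h : i = j + 1 ∨ j = i + 1) :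
      Rel n (E n i ^ 2 * Ebar n j - (v + v⁻¹) • (E n i * Ebar n j * E n i)
        + Ebar n j * E n i ^ 2) 0
  | serre_Fbar (i j : ℕ) (hi : i ∈ Set.Ico 1 n) (hj : j ∈ Set.Ico 1 n)
      (h : i = j + 1 ∨ j = i + 1) :
      Rel n (F n i ^ 2 * Fbar n j - (v + v⁻¹) • (F n i * Fbar n j * F n i)
        + Fbar n j * F n i ^ 2) 0

/-- The quantum queer superalgebra `U_v(𝔮_n)` as an associative algebra over `ℚ(v)`. -/
abbrev U (n : ℕ) : Type := RingQuot (Rel n)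

/-- The quotient map from the free algebra. -/
def proj (n : ℕ) : Free n →ₐ[Qv] U n := RingQuot.mkAlgHom Qv (Rel n)

/-! The generators of `U n`. -/

def K (n i : ℕ) : U n := proj n (Free.K n i)
def Kinv (n i : ℕ) : U n := proj n (Free.Kinv n i)
def Kbar (n i : ℕ) : U n := proj n (Free.Kbar n i)
def E (n j : ℕ) : U n := proj n (Free.E n j)
def F (n j : ℕ) : U n := proj n (Free.F n j)
def Ebar (n j : ℕ) : U n := proj n (Free.Ebar n j)
def Fbar (n j : ℕ) : U n := proj n (Free.Fbar n j)

/-- `evenPos n i d` is the even positive root vector `E_{i,i+d+1}`. -/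
def evenPos (n i : ℕ) : ℕ → U n
  | 0 => E n i
  | d + 1 => -(evenPos n i d * E n (i + d + 1)) + v⁻¹ • (E n (i + d + 1) * evenPos n i d)

/-- `oddPos n i d` is the odd positive root vector `Ē_{i,i+d+1}`. -/
def oddPos (n i : ℕ) : ℕ → U n
  | 0 => Ebar n i
  | d + 1 => -(evenPos n i d * Ebar n (i + d + 1)) + v⁻¹ • (Ebar n (i + d + 1) * evenPos n i d)

/-- `evenNeg n i d` is the even negative root vector `E_{i+d+1,i}`. -/
def evenNeg (n i : ℕ) : ℕ → U n
  | 0 => F n i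
  | d + 1 => -(F n (i + d + 1) * evenNeg n i d) + v • (evenNeg n i d * F n (i + d + 1))

/-- `oddNeg n i d` is the odd negative root vector `Ē_{i+d+1,i}`. -/
def oddNeg (n i : ℕ) : ℕ → U n
  | 0 => Fbar n i
  | d + 1 => -(Fbar n (i + d + 1) * evenNeg n i d) + v • (evenNeg n i d * Fbar n (i + d + 1))

/-- The even root vector `E_{a,b}`, for `a ≠ b` in `{1, …, n}`: positive if `a < b`, negative if
`b < a`. The value at `a = b` is never used. -/
def rootE (n a b : ℕ) : U n :=
  if a < b then evenPos n a (b - a - 1) else if b < a then evenNeg n b (a - b - 1) else 0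

/-- The odd root vector `Ē_{a,b}`, for `a ≠ b` in `{1, …, n}`: positive if `a < b`, negative if
`b < a`. The value at `a = b` is never used. -/
def rootEbar (n a b : ℕ) : U n :=
  if a < b then oddPos n a (b - a - 1) else if b < a then oddNeg n b (a - b - 1) else 0

end QuantumQueer

end

/-! Every root vector is an iterated twisted bracket `qbr q x y = -xy + q yx`, and such brackets
reassociate when the outer entries commute (`qbr_assoc`). Hence a root vector can be cut at any
intermediate index, and an odd root vector has only one odd letter, the generator of largest index.

Disjoint root vectors commute up to sign because their generators do. In the nested case, cutting
the long vector around index `m` reduces its commutator with `E_m` or `Ē_m` to two Cartan terms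
placed inside a double bracket. One is annihilated by the factor on its left, the other by the
factor on its right (`QCommute.qbr_qbr`).

The remaining cases need commutators of opposite root vectors. The commutator of two brackets whose
inner parts have opposite weights is a linear function `phi` of the commutator of the two new
generators (`commutator_qbr`). This function carries `K_c^{±1}` to `K_i^{±1}` and is linear over
elements that commute with the inner parts. Induction then gives `rootE_commutator`. An odd and an
even opposite pair give a term in `K̄_j` minus a Cartan element times some `s = phi(K̄_c)`. No
formula for `s` is needed: its commutation and anticommutation rules suffice, because its
contributions cancel or stay inside a commutator that also appears in the answer.

When the upper indices `j` and `l` differ, one odd vector is cut so that its odd piece anticommutes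
with the other vector, and only an odd-even commutator is left. When they coincide, the relations by
which `K̄_j` exchanges `E` and `Ē` turn the odd-odd anticommutator into an even-even and an odd-even
commutator (`anticommutator_of_twisted`). -/

noncomputable section

namespace QuantumQueer

/-! ### Scalar commutation and twisted brackets in an arbitrary algebra -/

section Algebra

variable {k A : Type*} [Field k] [Ring A] [Algebra k A]

/-- `x` and `y` commute up to the scalar `c`. -/
def QCommute (c : k) (x y : A) : Prop := x * y = c • (y * x)

/-- The twisted commutator by which root vectors are built. -/
def qbr (q : k) (x y : A) : A := -(x * y) + q • (y * x)

namespace QCommute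

variable {c d : k} {x y z : A}

theorem of_eq (h : x * y = y * x) : QCommute (1 : k) x y := by
  simpa [QCommute] using h

theorem eq (h : QCommute (1 : k) x y) : x * y = y * x := by
  simpa [QCommute] using h

theorem of_anti (h : x * y = -(y * x)) : QCommute (-1 : k) x y := by
  simpa [QCommute] using h

theorem anti (h : QCommute (-1 : k) x y) : x * y = -(y * x) := by
  simpa [QCommute] using h

theorem flip (hc : c ≠ 0) (h : QCommute c x y) : QCommute c⁻¹ y x := by
  unfold QCommute at *
  rw [h, smul_smul, inv_mul_cancel₀ hc, one_smul]

theorem symm_one (h : QCommute (1 : k) x y) : QCommute (1 : k) y x := .of_eq h.eq.symm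

theorem symm_neg (h : QCommute (-1 : k) x y) : QCommute (-1 : k) y x :=
  .of_anti (by rw [h.anti, neg_neg])

theorem mul_right (h : QCommute c x y) (h' : QCommute d x z) : QCommute (c * d) x (y * z) := by
  unfold QCommute at *
  rw [← mul_assoc, h, smul_mul_assoc, mul_assoc, h', mul_smul_comm, smul_smul, ← mul_assoc]

theorem mul_left (h : QCommute c x z) (h' : QCommute d y z) : QCommute (c * d) (x * y) z := by
  unfold QCommute at *
  rw [mul_assoc, h', mul_smul_comm, ← mul_assoc, h, smul_mul_assoc, smul_smul, mul_assoc,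
    mul_comm c]

theorem add_right (h : QCommute c x y) (h' : QCommute c x z) : QCommute c x (y + z) := by
  unfold QCommute at *
  rw [mul_add, h, h', add_mul, smul_add]

theorem sub_right (h : QCommute c x y) (h' : QCommute c x z) : QCommute c x (y - z) := by
  unfold QCommute at *
  rw [mul_sub, h, h', sub_mul, smul_sub]

theorem neg_right (h : QCommute c x y) : QCommute c x (-y) := by
  unfold QCommute at *
  rw [mul_neg, h, neg_mul, smul_neg]

theorem smul_right (a : k) (h : QCommute c x y) : QCommute c x (a • y) := by
  unfold QCommute at *
  rw [mul_smul_comm, h, smul_mul_assoc, smul_comm]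

theorem qbr_right (q : k) (h : QCommute c x y) (h' : QCommute d x z) :
    QCommute (c * d) x (qbr q y z) :=
  (h.mul_right h').neg_right.add_right (.smul_right q (by simpa [mul_comm] using h'.mul_right h))

theorem inv_left {x' : A} (hc : c ≠ 0) (h₁ : x * x' = 1) (h₂ : x' * x = 1) (h : QCommute c x y) :
    QCommute c⁻¹ x' y := by
  unfold QCommute at *
  have : x' * (x * y) * x' = c • (x' * (y * x) * x') := by rw [h]; simp
  rw [← mul_assoc, h₂, one_mul, mul_assoc, mul_assoc, h₁, mul_one] at this
  rw [this, smul_smul, inv_mul_cancel₀ hc, one_smul]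

end QCommute

theorem qbr_neg_right (q : k) (x y : A) : qbr q x (-y) = -qbr q x y := by
  simp only [qbr, mul_neg, neg_mul, smul_neg, neg_add]

/-- Both sides expand into the same four products once `x` and `z` are exchanged. This is what
allows root vectors to be cut at any intermediate index. -/
theorem qbr_assoc (q : k) {x z : A} (y : A) (h : x * z = z * x) :
    qbr q (qbr q x y) z = qbr q x (qbr q y z) := by
  have h' (w : A) : x * (z * w) = z * (x * w) := by rw [← mul_assoc, h, mul_assoc]
  simp only [qbr, mul_add, add_mul, mul_neg, neg_mul, smul_mul_assoc, mul_smul_comm, mul_assoc, h,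
    h', smul_add, smul_neg]
  module

theorem smul_sub_eq_neg_smul_sub (a : k) (x y : A) : a • (x - y) = -a • (y - x) := by
  rw [neg_smul, ← smul_neg, neg_sub]

/-- For `c = q` the bracket vanishes, which removes unwanted Cartan terms. For `c = q⁻¹` it produces
the coefficient `q - q⁻¹` of the final formulas. -/
theorem qbr_eq_smul {q c : k} {x y : A} (h : QCommute c x y) : qbr q x y = (q - c) • (y * x) := by
  rw [qbr, h, sub_smul, sub_eq_neg_add]

theorem qbr_smul_sub_left (q a : k) (x y z : A) :
    qbr q (a • (x - y)) z = a • (qbr q x z - qbr q y z) := by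
  simp only [qbr, mul_sub, sub_mul, smul_mul_assoc, mul_smul_comm, smul_sub]
  module

theorem qbr_sub_left (q : k) (x y z : A) : qbr q (x - y) z = qbr q x z - qbr q y z := by
  simpa only [one_smul] using qbr_smul_sub_left q (1 : k) x y z

/-- The bracket annihilates `p`, so nothing need be known about `y` against `p`. -/
theorem QCommute.qbr_sub_right {q c d : k} {y p r x : A} (hp : QCommute q p x)
    (hr : QCommute c y r) (hx : QCommute d y x) : QCommute (c * d) y (qbr q (p - r) x) := by
  rw [qbr_sub_left, qbr_eq_smul hp, sub_self, zero_smul, zero_sub]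
  exact (hr.qbr_right q hx).neg_right

/-- An element commuting with `x`, `z` commutes with `qbr q z (qbr q f x)` when its commutator with
`f` splits into a part annihilated by `z` and one annihilated by `x`. -/
theorem QCommute.qbr_qbr {q : k} {a : k} {y x z f w₁ w₂ : A} (hx : QCommute (1 : k) y x)
    (hz : QCommute (1 : k) y z) (hxz : z * x = x * z) (hf : y * f - f * y = a • (w₁ - w₂))
    (h₁ : QCommute q z w₁) (h₂ : QCommute q w₂ x) :
    QCommute (1 : k) y (qbr q z (qbr q f x)) := by
  have key : y * qbr q z (qbr q f x) - qbr q z (qbr q f x) * y =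
      qbr q z (qbr q (y * f - f * y) x) := by
    have hx' (w : A) : y * (x * w) = x * (y * w) := by rw [← mul_assoc, hx.eq, mul_assoc]
    have hz' (w : A) : y * (z * w) = z * (y * w) := by rw [← mul_assoc, hz.eq, mul_assoc]
    simp only [qbr, mul_add, add_mul, mul_sub, sub_mul, mul_neg, neg_mul, smul_mul_assoc,
      mul_smul_comm, mul_assoc, smul_add, smul_sub, smul_neg, hx.eq, hz.eq, hx', hz']
    module
  refine .of_eq (sub_eq_zero.1 ?_)
  rw [key, hf, qbr_smul_sub_left, qbr_eq_smul h₂, sub_self, zero_smul, sub_zero]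
  have : qbr q z (a • qbr q w₁ x) = a • qbr q z (qbr q w₁ x) := by
    simp only [qbr, mul_smul_comm, smul_mul_assoc]
    module
  -- After reassociation `z` meets `w₁` before `x` does, and `qbr q z w₁ = 0`.
  rw [this, ← qbr_assoc q _ hxz, qbr_eq_smul h₁, sub_self, zero_smul]
  simp [qbr]

/-! ### Commutators of brackets of opposite weights -/

/-- The commutator of `qbr q a f` and `qbr q⁻¹ e b` as a function of `g = a * b - b * a`, where
`e * f - f * e = (q - q⁻¹)⁻¹ • (κ - κ')`. -/
def phi (q : k) (e f κ κ' g : A) : A :=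
  e * g * f + f * g * e - q⁻¹ • (g * f * e) - q • (f * e * g)
    - (q - q⁻¹)⁻¹ • (g * (q⁻¹ • κ - q • κ'))

theorem phi_sub (q : k) (e f κ κ' g g' : A) :
    phi q e f κ κ' (g - g') = phi q e f κ κ' g - phi q e f κ κ' g' := by
  simp only [phi, mul_sub, sub_mul, smul_sub]; abel

theorem phi_smul (q : k) (e f κ κ' : A) (a : k) (g : A) :
    phi q e f κ κ' (a • g) = a • phi q e f κ κ' g := by
  simp only [phi, smul_sub, smul_add, mul_smul_comm, smul_mul_assoc, smul_comm a]

theorem phi_mul (q : k) {e f y : A} (κ κ' g : A) (he : y * e = e * y) (hf : y * f = f * y) :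
    phi q e f κ κ' (y * g) = y * phi q e f κ κ' g := by
  have he' (w : A) : y * (e * w) = e * (y * w) := by rw [← mul_assoc, he, mul_assoc]
  have hf' (w : A) : y * (f * w) = f * (y * w) := by rw [← mul_assoc, hf, mul_assoc]
  simp only [phi, mul_sub, mul_add, mul_smul_comm, mul_assoc, he', hf']

theorem QCommute.phi_right {q c : k} {e f κ κ' g y : A} (he : QCommute (1 : k) y e)
    (hf : QCommute (1 : k) y f) (hκ : QCommute (1 : k) y κ) (hκ' : QCommute (1 : k) y κ')
    (hg : QCommute c y g) : QCommute c y (phi q e f κ κ' g) := by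
  refine .sub_right (.sub_right (.sub_right (.add_right ?_ ?_) (.smul_right _ ?_))
    (.smul_right _ ?_)) (.smul_right _ ?_)
  · simpa using (he.mul_right hg).mul_right hf
  · simpa using (hf.mul_right hg).mul_right he
  · simpa using (hg.mul_right hf).mul_right he
  · simpa using (hf.mul_right he).mul_right hg
  · simpa using hg.mul_right ((hκ.smul_right q⁻¹).sub_right (hκ'.smul_right q))

/-- Expansion leaves terms containing `a * b - b * a` and terms containing `e * f - f * e`. Moving
the Cartan values of the latter past `a` and `b` makes them recombine into multiples of `a * b - b *
a` as well. -/
theorem commutator_qbr {q : k} (hq : q ≠ 0) {a b e f κ κ' : A} (hae : a * e = e * a)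
    (hbf : b * f = f * b) (hef : e * f - f * e = (q - q⁻¹)⁻¹ • (κ - κ'))
    (hκa : QCommute q κ a) (hκb : QCommute q⁻¹ κ b)
    (hκa' : QCommute q⁻¹ κ' a) (hκb' : QCommute q κ' b) :
    qbr q a f * qbr q⁻¹ e b - qbr q⁻¹ e b * qbr q a f = phi q e f κ κ' (a * b - b * a) := by
  have hae' (w : A) : a * (e * w) = e * (a * w) := by rw [← mul_assoc, hae, mul_assoc]
  have hbf' (w : A) : b * (f * w) = f * (b * w) := by rw [← mul_assoc, hbf, mul_assoc]
  have key : qbr q a f * qbr q⁻¹ e b - qbr q⁻¹ e b * qbr q a f =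
      e * (a * b - b * a) * f + f * (a * b - b * a) * e - q⁻¹ • ((a * b - b * a) * f * e)
        - q • (f * e * (a * b - b * a))
        - b * (e * f - f * e) * a - a * (e * f - f * e) * b + q⁻¹ • (b * a * (e * f - f * e))
        + q • ((e * f - f * e) * b * a) := by
    simp only [qbr, mul_add, add_mul, mul_sub, sub_mul, mul_neg, neg_mul, smul_mul_assoc,
      mul_smul_comm, mul_assoc, smul_add, smul_sub, smul_neg, hae, hae', hbf, hbf', smul_smul,
      mul_inv_cancel₀ hq, inv_mul_cancel₀ hq]
    module
  unfold QCommute at *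
  rw [key, hef, phi]
  simp only [mul_sub, sub_mul, smul_mul_assoc, mul_smul_comm, mul_assoc, smul_sub, hκa, hκb,
    hκa', hκb', smul_smul]
  match_scalars <;> field_simp <;> ring

/-- Since `z` scales oppositely against `e` and `f`, it can be pulled out to the left, and the first
four terms of `phi` collapse to `q • (e * f - f * e)`. The subtracted Cartan term then leaves `κ`
alone. For `z = K_c` and `κ = K_i K_c⁻¹` the result is `K_i`. -/
theorem phi_eq_mul_left {q : k} (hq : q ≠ 0) (hd : q - q⁻¹ ≠ 0) {e f κ κ' z : A}
    (hef : e * f - f * e = (q - q⁻¹)⁻¹ • (κ - κ'))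
    (he : QCommute q⁻¹ z e) (hf : QCommute q z f) : phi q e f κ κ' z = z * κ := by
  have h₁ : e * z = q • (z * e) := by simpa [QCommute] using he.flip (inv_ne_zero hq)
  have h₂ : f * z = q⁻¹ • (z * f) := hf.flip hq
  have key : phi q e f κ κ' z = z * (q • (e * f - f * e)
      - (q - q⁻¹)⁻¹ • (q⁻¹ • κ - q • κ')) := by
    rw [phi, h₁, h₂, mul_assoc f, h₁, mul_smul_comm, ← mul_assoc, h₂]
    simp only [mul_sub, smul_mul_assoc, mul_smul_comm, mul_assoc, smul_smul, mul_inv_cancel₀ hq,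
      smul_sub]
    module
  rw [key, hef, smul_comm, ← smul_sub]
  have : q • (κ - κ') - (q⁻¹ • κ - q • κ') = (q - q⁻¹) • κ := by module
  rw [this, smul_smul, inv_mul_cancel₀ hd, one_smul]

theorem phi_eq_mul_right {q : k} (hq : q ≠ 0) (hd : q - q⁻¹ ≠ 0) {e f κ κ' z : A}
    (hef : e * f - f * e = (q - q⁻¹)⁻¹ • (κ - κ'))
    (he : QCommute q z e) (hf : QCommute q⁻¹ z f) : phi q e f κ κ' z = z * κ' := by
  have h₁ : e * z = q⁻¹ • (z * e) := he.flip hq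
  have h₂ : f * z = q • (z * f) := by simpa [QCommute] using hf.flip (inv_ne_zero hq)
  have key : phi q e f κ κ' z = z * (q⁻¹ • (e * f - f * e)
      - (q - q⁻¹)⁻¹ • (q⁻¹ • κ - q • κ')) := by
    rw [phi, h₁, h₂, mul_assoc f, h₁, mul_smul_comm, ← mul_assoc, h₂]
    simp only [mul_sub, smul_mul_assoc, mul_smul_comm, mul_assoc, smul_smul, inv_mul_cancel₀ hq,
      smul_sub]
    module
  rw [key, hef, smul_comm, ← smul_sub]
  have : q⁻¹ • (κ - κ') - (q⁻¹ • κ - q • κ') = (q - q⁻¹) • κ' := by module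
  rw [this, smul_smul, inv_mul_cancel₀ hd, one_smul]

/-! ### Action of odd Cartan elements and products of odd elements -/

/-- An odd Cartan element acting on `x` with result `y` acts on `qbr p u x` with result
`qbr p u y` if it commutes with `u`. -/
theorem twisted_qbr_left (p q σ : k) {b κ u x y : A} (hb : QCommute (1 : k) b u)
    (hκ : QCommute (1 : k) κ u) (h : q • (b * x) + σ • (x * b) = κ * y) :
    q • (b * qbr p u x) + σ • (qbr p u x * b) = κ * qbr p u y := by
  have hb' (w : A) : b * (u * w) = u * (b * w) := by rw [← mul_assoc, hb.eq, mul_assoc]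
  have hκ' (w : A) : κ * (u * w) = u * (κ * w) := by rw [← mul_assoc, hκ.eq, mul_assoc]
  have : κ * qbr p u y = qbr p u (κ * y) := by
    simp only [qbr, mul_add, mul_neg, mul_smul_comm, mul_assoc, hκ']
  rw [this, ← h]
  simp only [qbr, mul_add, add_mul, mul_neg, neg_mul, mul_smul_comm, smul_mul_assoc, mul_assoc,
    hb', hb.eq, smul_add, smul_neg]
  module

theorem twisted_qbr_right (p q σ : k) {b κ u x y : A} (hb : QCommute (1 : k) b u)
    (hκ : QCommute (1 : k) κ u) (h : q • (b * x) + σ • (x * b) = κ * y) :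
    q • (b * qbr p x u) + σ • (qbr p x u * b) = κ * qbr p y u := by
  have hb' (w : A) : b * (u * w) = u * (b * w) := by rw [← mul_assoc, hb.eq, mul_assoc]
  have hκ' (w : A) : κ * (u * w) = u * (κ * w) := by rw [← mul_assoc, hκ.eq, mul_assoc]
  have : κ * qbr p y u = qbr p (κ * y) u := by
    simp only [qbr, mul_add, mul_neg, mul_smul_comm, mul_assoc, hκ']
  rw [this, ← h]
  simp only [qbr, mul_add, add_mul, mul_neg, neg_mul, mul_smul_comm, smul_mul_assoc, mul_assoc,
    hb', hb.eq, smul_add, smul_neg]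
  module

theorem mul_qbr_of_anti (q : k) {x e w : A} (h : QCommute (-1 : k) x w) :
    x * qbr q e w = -(qbr q e w * x) - (x * e - e * x) * w - q • (w * (x * e - e * x)) := by
  have h' (y : A) : x * (w * y) = -(w * (x * y)) := by
    rw [← mul_assoc, h.anti, neg_mul, mul_assoc]
  simp only [qbr, mul_add, add_mul, mul_neg, neg_mul, mul_smul_comm, smul_mul_assoc, mul_assoc,
    h', h.anti, mul_sub, sub_mul, smul_sub, smul_neg]
  module

theorem qbr_mul_of_anti (q : k) {x f w : A} (h : QCommute (-1 : k) w x) :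
    qbr q w f * x = -(x * qbr q w f) - w * (f * x - x * f) - q • ((f * x - x * f) * w) := by
  have h' (y : A) : w * (x * y) = -(x * (w * y)) := by
    rw [← mul_assoc, h.anti, neg_mul, mul_assoc]
  simp only [qbr, mul_add, add_mul, mul_neg, neg_mul, mul_smul_comm, smul_mul_assoc, mul_assoc,
    h', h.anti, mul_sub, sub_mul, smul_sub, smul_neg]
  module

/-- The scalar in `hr` is the one for which `r * w + q • (w * r) = 0`, so only the `p` part of the
commutator survives. -/
theorem mul_qbr_eq {q : k} (hq : q ≠ 0) {x e w p r : A} (h : QCommute (-1 : k) x w)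
    (hg : x * e - e * x = p - r) (hr : QCommute (-1 * q⁻¹) w r) :
    x * qbr q e w = -(qbr q e w * x) - p * w - q • (w * p) := by
  rw [mul_qbr_of_anti q h, hg, mul_sub, hr]
  simp only [sub_mul, smul_sub, smul_smul, neg_mul, one_mul, mul_neg, mul_inv_cancel₀ hq]
  module

theorem qbr_mul_eq {q : k} {x f w p r : A} (h : QCommute (-1 : k) w x)
    (hg : f * x - x * f = p - r) (hr : QCommute (-1 * q) w r) :
    qbr q w f * x = -(x * qbr q w f) - w * p - q • (p * w) := by
  rw [qbr_mul_of_anti q h, hg, mul_sub, hr]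
  simp only [sub_mul, smul_sub]
  module

theorem qbr_commutator_left (q : k) {x y e : A} (h : QCommute (1 : k) y e) :
    qbr q x y * e - e * qbr q x y = qbr q (x * e - e * x) y := by
  have h' (w : A) : y * (e * w) = e * (y * w) := by rw [← mul_assoc, h.eq, mul_assoc]
  simp only [qbr, mul_add, add_mul, mul_neg, neg_mul, mul_smul_comm, smul_mul_assoc, mul_assoc,
    h', h.eq, mul_sub, sub_mul, smul_sub]
  module

/-- The anticommutator of two odd elements, both obtained from even ones by the action of the same
odd Cartan element `b`. -/
theorem anticommutator_of_twisted {q : k} (hq : q ≠ 0) {b κ κ' e e' f f' : A} (hκ : κ * κ' = 1)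
    (he : QCommute q⁻¹ κ e) (hf' : QCommute q κ f')
    (h₁ : q • (b * e) + (-1 : k) • (e * b) = κ' * -e')
    (h₂ : q • (b * f') + (1 : k) • (f' * b) = κ * f) :
    f' * e' + e' * f' = κ * κ * (e * f - f * e) + q • (κ * b * (f' * e - e * f'))
      + q⁻¹ • ((f' * e - e * f') * (κ * b)) := by
  unfold QCommute at *
  -- The two relations are solved for `e'` and for `f' * (κ * b)`. Substituting both leaves products
  -- of `κ`, `b` and the pairs `e`, `f` and `e`, `f'`.
  have e₁ : e' = -q • (κ * (b * e)) + q⁻¹ • (e * (κ * b)) := by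
    have := congrArg (κ * ·) h₁
    simp only [mul_add, mul_smul_comm, ← mul_assoc, hκ, one_mul] at this
    rw [he] at this
    simp only [smul_mul_assoc, mul_assoc] at this
    linear_combination (norm := module) this
  have e₂ : f' * (κ * b) = q⁻¹ • (κ * (κ * f)) - κ * (b * f') := by
    have h₃ : κ * (b * f') = q⁻¹ • (κ * (κ * f)) - q⁻¹ • (κ * f' * b) := by
      rw [mul_assoc, ← h₂]
      simp only [mul_add, mul_smul_comm, smul_add, smul_smul, inv_mul_cancel₀ hq]
      module
    rw [h₃, hf', smul_mul_assoc, smul_smul, inv_mul_cancel₀ hq, one_smul, mul_assoc]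
    abel
  have e₃ : f' * (κ * (b * e)) = q⁻¹ • (κ * (κ * (f * e))) - κ * (b * (f' * e)) := by
    simpa only [sub_mul, smul_mul_assoc, mul_assoc] using congrArg (· * e) e₂
  have e₄ : κ * (b * f') = q⁻¹ • (κ * (κ * f)) - f' * (κ * b) := by rw [e₂]; abel
  have e₅ : e * (κ * (κ * f)) = q • q • (κ * (κ * (e * f))) := by
    have : e * κ = q • (κ * e) := by rw [he, smul_smul, mul_inv_cancel₀ hq, one_smul]
    rw [← mul_assoc, this, smul_mul_assoc, mul_assoc, ← mul_assoc e, this, smul_mul_assoc,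
      mul_smul_comm, mul_assoc]
  rw [e₁]
  simp only [mul_add, add_mul, mul_sub, sub_mul, mul_smul_comm, smul_mul_assoc, mul_assoc, e₃, e₄,
    e₅, smul_sub, smul_smul]
  match_scalars <;> field_simp

/-- Here `κ * b` anticommutes with `e * f' - f' * e`, so the terms with coefficients `q` and `q⁻¹`
merge into one with coefficient `q - q⁻¹`. -/
theorem anticommutator_of_twisted_neg {q : k} (hq : q ≠ 0) {b κ κ' e e' f f' : A}
    (hκ : κ * κ' = 1) (he : QCommute q⁻¹ κ e) (hf' : QCommute q κ f')
    (h₁ : q • (b * e) + (-1 : k) • (e * b) = κ' * e')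
    (h₂ : q • (b * f') + (1 : k) • (f' * b) = κ * f) (hb : QCommute (-1 : k) b (e * f' - f' * e))
    (hg : QCommute (1 : k) κ (e * f' - f' * e)) :
    e' * f' = -(f' * e') - κ * κ * (e * f - f * e)
      - (q - q⁻¹) • ((e * f' - f' * e) * κ * b) := by
  have h := anticommutator_of_twisted (e' := -e') hq hκ he hf' (by rw [neg_neg]; exact h₁) h₂
  have hbg : κ * b * (e * f' - f' * e) = -((e * f' - f' * e) * (κ * b)) := by
    rw [mul_assoc, hb.anti, mul_neg, ← mul_assoc, hg.eq, mul_assoc]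
  have hs : f' * e - e * f' = -(e * f' - f' * e) := (neg_sub _ _).symm
  rw [hs, mul_neg (κ * b), hbg, neg_neg, neg_mul (e * f' - f' * e)] at h
  rw [mul_assoc _ κ b]
  simp only [mul_neg, neg_mul] at h
  linear_combination (norm := module) -h

/-- Unlike in the previous lemma, the odd-even commutator contains `b` itself, which commutes with
`κ * b`. This is the source of the extra term in `b ^ 2`. -/
theorem anticommutator_of_opposite {q : k} (hq : q ≠ 0)
    (hd' : q ^ 2 - q⁻¹ ^ 2 ≠ 0) {b κ κ' μ μ' e e' f f' s : A}
    (hκ : κ * κ' = 1) (he : QCommute q⁻¹ κ e) (hf' : QCommute q κ f')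
    (h₁ : q • (b * e) + (-1 : k) • (e * b) = κ' * -e')
    (h₂ : q • (b * f') + (1 : k) • (f' * b) = κ * f)
    (hef : e * f - f * e = (q - q⁻¹)⁻¹ • (μ * κ' - μ' * κ))
    (hg : f' * e - e * f' = b * μ' - κ' * s)
    (hb : b ^ 2 = (q ^ 2 - q⁻¹ ^ 2)⁻¹ • (κ ^ 2 - κ' ^ 2))
    (hκb : QCommute (1 : k) κ b) (hκ'b : QCommute (1 : k) κ' b) (hμb : QCommute (1 : k) μ' b)
    (hμκ : QCommute (1 : k) μ κ) (hμκ' : QCommute (1 : k) μ' κ) (hμκ'' : QCommute (1 : k) μ' κ')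
    (hκκ' : QCommute (1 : k) κ κ') (hbs : QCommute (-1 : k) b s) (hκs : QCommute (1 : k) κ s) :
    f' * e' = -(e' * f') + (q - q⁻¹)⁻¹ • (κ * μ - μ' * κ') + (q - q⁻¹) • (b ^ 2 * μ' * κ)
      - (q - q⁻¹) • ((f' * e - e * f') * κ * b) := by
  have h := anticommutator_of_twisted hq hκ he hf' h₁ h₂
  -- The `b * μ'` part contributes twice and the `κ' * s` part cancels, so `s` drops out.
  have hcomm : κ * b * (f' * e - e * f') + (f' * e - e * f') * (κ * b)
      = (2 : k) • (b ^ 2 * μ' * κ) := by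
    have t₁ : κ * b * (b * μ') = b ^ 2 * μ' * κ := by
      rw [sq, hκb.eq, mul_assoc b κ, ← mul_assoc κ, hκb.eq, mul_assoc b κ, ← hμκ'.eq]
      simp only [mul_assoc]
    have t₂ : b * μ' * (κ * b) = b ^ 2 * μ' * κ := by
      rw [sq, hκb.eq, mul_assoc b, ← mul_assoc μ', hμb.eq]
      simp only [mul_assoc]
    have t₃ : κ * b * (κ' * s) = -(κ' * s * (κ * b)) := by
      rw [mul_assoc κ, ← mul_assoc b, ← hκ'b.eq, mul_assoc κ', hbs.anti, mul_neg, mul_neg,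
        ← mul_assoc κ, hκκ'.eq, mul_assoc κ', ← mul_assoc κ, hκs.eq]
      simp only [mul_assoc]
    rw [hg, mul_sub, sub_mul, t₁, t₂, t₃, two_smul]
    abel
  have hcart : κ * κ * (e * f - f * e) = (q - q⁻¹)⁻¹ • (κ * μ - μ' * κ * κ ^ 2) := by
    rw [hef, mul_smul_comm, mul_sub]
    congr 2
    · rw [← mul_assoc, mul_assoc κ, ← hμκ.eq, mul_assoc, mul_assoc, hκ, mul_one, hμκ.eq]
    · rw [sq, mul_assoc μ', ← mul_assoc κ κ κ, ← mul_assoc, mul_assoc κ, ← hμκ'.eq, ← mul_assoc κ,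
        ← hμκ'.eq]
      simp only [mul_assoc]
  have hsq : b ^ 2 * μ' * κ = (q ^ 2 - q⁻¹ ^ 2)⁻¹ • (μ' * κ * κ ^ 2 - μ' * κ') := by
    rw [hb, smul_mul_assoc, smul_mul_assoc, sub_mul, sub_mul]
    congr 2
    · rw [sq, mul_assoc _ μ', hμκ'.eq]
      have : κ * (μ' * κ) = μ' * κ * κ := by rw [← mul_assoc, ← hμκ'.eq]
      rw [mul_assoc κ, ← hμκ'.eq, this, ← mul_assoc, ← mul_assoc, ← hμκ'.eq]
      simp only [mul_assoc]
    · rw [sq, mul_assoc _ μ', hμκ'.eq, mul_assoc κ' κ', ← mul_assoc κ' κ, ← hκκ'.eq, hκ, one_mul,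
        hμκ''.eq]
  have h' : f' * e' = -(e' * f') + κ * κ * (e * f - f * e) + (2 * q) • (b ^ 2 * μ' * κ)
      - (q - q⁻¹) • ((f' * e - e * f') * κ * b) := by
    rw [mul_assoc _ κ b]
    linear_combination (norm := module) h + q • hcomm
  -- The coefficient `2q` splits as `(q - q⁻¹) + (q + q⁻¹)`. By the formula for `b ^ 2`, the second
  -- part cancels the term `μ' * κ * κ ^ 2` of the even commutator and supplies `μ' * κ'`.
  have hcoeff : (q + q⁻¹) * (q ^ 2 - q⁻¹ ^ 2)⁻¹ = (q - q⁻¹)⁻¹ := by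
    have hmul : q ^ 2 - q⁻¹ ^ 2 = (q - q⁻¹) * (q + q⁻¹) := by ring
    have hs : q + q⁻¹ ≠ 0 := right_ne_zero_of_mul (hmul ▸ hd')
    rw [hmul, mul_inv, mul_comm (q - q⁻¹)⁻¹, ← mul_assoc, mul_inv_cancel₀ hs, one_mul]
  rw [h', hcart]
  have h'' : (q + q⁻¹) • (b ^ 2 * μ' * κ) = (q - q⁻¹)⁻¹ • (μ' * κ * κ ^ 2 - μ' * κ') := by
    rw [hsq, smul_smul, hcoeff]
  linear_combination (norm := module) h''

/-- Since `κ` is invertible, `f'` is an expression in `κ'`, `b` and `f`, linear in `b`; the scalar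
of `b` is inherited. -/
theorem QCommute.of_twisted {q c : k} {y b κ κ' f f' : A} (hκ : κ' * κ = 1)
    (hb : QCommute c y b) (hf : QCommute (1 : k) y f) (hκ' : QCommute (1 : k) y κ')
    (h : q • (b * f) + (-1 : k) • (f * b) = κ * f') : QCommute c y f' := by
  have : f' = κ' * (q • (b * f) + (-1 : k) • (f * b)) := by
    rw [h, ← mul_assoc, hκ, one_mul]
  rw [this]
  have h₁ : QCommute c y (b * f) := by simpa only [mul_one] using hb.mul_right hf
  have h₂ : QCommute c y (f * b) := by simpa only [one_mul] using hf.mul_right hb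
  simpa only [one_mul] using hκ'.mul_right ((h₁.smul_right q).add_right (h₂.smul_right (-1)))

end Algebra

/-! ### Nonvanishing scalars in `ℚ(v)` -/

theorem v_ne_zero : v ≠ 0 := RatFunc.X_ne_zero

theorem v_pow_four_ne_one : v ^ 4 ≠ 1 := by
  intro h
  have h' : (Polynomial.X ^ 4 : Polynomial ℚ) = 1 := by
    apply RatFunc.algebraMap_injective ℚ
    simpa [v] using h
  simpa using congrArg Polynomial.natDegree h'

theorem v_sub_inv_ne_zero : v - v⁻¹ ≠ 0 := by
  intro h
  apply v_pow_four_ne_one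
  have : v * v = 1 := by
    have h' := sub_eq_zero.1 h
    nth_rewrite 2 [h']
    exact mul_inv_cancel₀ v_ne_zero
  linear_combination (v * v + 1) * this

theorem v_sq_sub_inv_sq_ne_zero : v ^ 2 - v⁻¹ ^ 2 ≠ 0 := by
  intro h
  apply v_pow_four_ne_one
  have : v ^ 2 * v ^ 2 = 1 := by
    have h' := sub_eq_zero.1 h
    nth_rewrite 2 [h']
    rw [← mul_pow, mul_inv_cancel₀ v_ne_zero, one_pow]
  linear_combination this

variable {n a b c i j k l m : ℕ}

theorem proj_eq {x y : Free n} (h : Rel n x y) : proj n x = proj n y :=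
  RingQuot.mkAlgHom_rel Qv h

@[simp]
theorem proj_K (i : ℕ) : proj n (Free.K n i) = K n i := rfl

@[simp]
theorem proj_Kinv (i : ℕ) : proj n (Free.Kinv n i) = Kinv n i := rfl

@[simp]
theorem proj_Kbar (i : ℕ) : proj n (Free.Kbar n i) = Kbar n i := rfl

@[simp]
theorem proj_E (i : ℕ) : proj n (Free.E n i) = E n i := rfl

@[simp]
theorem proj_F (i : ℕ) : proj n (Free.F n i) = F n i := rfl

@[simp]
theorem proj_Ebar (i : ℕ) : proj n (Free.Ebar n i) = Ebar n i := rfl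

@[simp]
theorem proj_Fbar (i : ℕ) : proj n (Free.Fbar n i) = Fbar n i := rfl

/-! ### Defining relations in the quotient algebra -/

section Relations

theorem K_mul_Kinv (hi : i ∈ Set.Icc 1 n) : K n i * Kinv n i = 1 := by
  simpa using proj_eq (.K_Kinv i hi)

theorem Kinv_mul_K (hi : i ∈ Set.Icc 1 n) : Kinv n i * K n i = 1 := by
  simpa using proj_eq (.Kinv_K i hi)

theorem qcommute_K_K (hi : i ∈ Set.Icc 1 n) (hj : j ∈ Set.Icc 1 n) :
    QCommute (1 : Qv) (K n i) (K n j) :=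
  .of_eq (by simpa using proj_eq (.K_K i j hi hj))

theorem qcommute_K_Kbar (hi : i ∈ Set.Icc 1 n) (hj : j ∈ Set.Icc 1 n) :
    QCommute (1 : Qv) (K n i) (Kbar n j) :=
  .of_eq (by simpa using proj_eq (.K_Kbar i j hi hj))

theorem QCommute.Kinv_left {c : Qv} {y : U n} (hc : c ≠ 0) (hi : i ∈ Set.Icc 1 n)
    (h : QCommute c (K n i) y) : QCommute c⁻¹ (Kinv n i) y :=
  h.inv_left hc (K_mul_Kinv hi) (Kinv_mul_K hi)

theorem QCommute.Kinv_left_one {y : U n} (hi : i ∈ Set.Icc 1 n)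
    (h : QCommute (1 : Qv) (K n i) y) : QCommute (1 : Qv) (Kinv n i) y := by
  simpa using h.Kinv_left one_ne_zero hi

theorem Kbar_sq (hi : i ∈ Set.Icc 1 n) :
    Kbar n i ^ 2 = (v ^ 2 - v⁻¹ ^ 2)⁻¹ • (K n i ^ 2 - Kinv n i ^ 2) := by
  have h : Kbar n i * Kbar n i + Kbar n i * Kbar n i =
      (2 / (v ^ 2 - v⁻¹ ^ 2)) • (K n i ^ 2 - Kinv n i ^ 2) := by
    have := proj_eq (.Kbar_Kbar i i hi hi)
    rw [if_pos rfl] at this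
    simpa only [map_add, map_mul, map_smul, map_sub, map_pow, proj_Kbar, proj_K, proj_Kinv] using this
  rw [← two_smul Qv, div_eq_mul_inv, mul_smul] at h
  rw [sq]
  exact smul_right_injective _ (two_ne_zero' Qv) h

theorem qcommute_Kbar_Kbar (hi : i ∈ Set.Icc 1 n) (hj : j ∈ Set.Icc 1 n) (h : i ≠ j) :
    QCommute (-1 : Qv) (Kbar n i) (Kbar n j) := by
  have := proj_eq (.Kbar_Kbar i j hi hj)
  rw [if_neg h] at this
  exact .of_anti (eq_neg_of_add_eq_zero_left (by simpa using this))

theorem qcommute_K_E (hi : i ∈ Set.Icc 1 n) (hj : j ∈ Set.Ico 1 n) :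
    QCommute (v ^ pairing i j) (K n i) (E n j) := by
  simpa only [map_mul, map_smul] using! proj_eq (.K_E i j hi hj)

theorem qcommute_K_Ebar (hi : i ∈ Set.Icc 1 n) (hj : j ∈ Set.Ico 1 n) :
    QCommute (v ^ pairing i j) (K n i) (Ebar n j) := by
  simpa only [map_mul, map_smul] using! proj_eq (.K_Ebar i j hi hj)

theorem qcommute_K_F (hi : i ∈ Set.Icc 1 n) (hj : j ∈ Set.Ico 1 n) :
    QCommute (v ^ (-pairing i j)) (K n i) (F n j) := by
  simpa only [map_mul, map_smul] using! proj_eq (.K_F i j hi hj)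

theorem qcommute_K_Fbar (hi : i ∈ Set.Icc 1 n) (hj : j ∈ Set.Ico 1 n) :
    QCommute (v ^ (-pairing i j)) (K n i) (Fbar n j) := by
  simpa only [map_mul, map_smul] using! proj_eq (.K_Fbar i j hi hj)

theorem Kbar_succ_E (hj : j ∈ Set.Ico 1 n) :
    v • (Kbar n (j + 1) * E n j) + (-1 : Qv) • (E n j * Kbar n (j + 1)) =
      Kinv n (j + 1) * -Ebar n j := by
  have := proj_eq (.Kbar_E_pred j hj)
  simp only [map_mul, map_smul, map_sub, map_neg] at this
  rw [neg_one_smul Qv (E n j * _), ← sub_eq_add_neg, mul_neg (Kinv n (j + 1)) (Ebar n j)]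
  exact this

theorem Kbar_succ_F (hj : j ∈ Set.Ico 1 n) :
    v • (Kbar n (j + 1) * F n j) + (-1 : Qv) • (F n j * Kbar n (j + 1)) =
      K n (j + 1) * Fbar n j := by
  have := proj_eq (.Kbar_F_pred j hj)
  simp only [map_mul, map_smul, map_sub] at this
  rw [neg_one_smul Qv (F n j * _), ← sub_eq_add_neg]
  exact this

theorem Kbar_succ_Ebar (hj : j ∈ Set.Ico 1 n) :
    v • (Kbar n (j + 1) * Ebar n j) + (1 : Qv) • (Ebar n j * Kbar n (j + 1)) =
      Kinv n (j + 1) * E n j := by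
  have := proj_eq (.Kbar_Ebar_pred j hj)
  simp only [map_mul, map_smul, map_add] at this
  rw [one_smul]
  exact this

theorem Kbar_succ_Fbar (hj : j ∈ Set.Ico 1 n) :
    v • (Kbar n (j + 1) * Fbar n j) + (1 : Qv) • (Fbar n j * Kbar n (j + 1)) =
      K n (j + 1) * F n j := by
  have := proj_eq (.Kbar_Fbar_pred j hj)
  simp only [map_mul, map_smul, map_add] at this
  rw [one_smul]
  exact this

theorem qcommute_Kbar_E (hi : i ∈ Set.Icc 1 n) (hj : j ∈ Set.Ico 1 n) (h : i ≠ j)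
    (h' : i ≠ j + 1) : QCommute (1 : Qv) (Kbar n i) (E n j) :=
  .of_eq (sub_eq_zero.1 (by simpa using proj_eq (.Kbar_E_far i j hi hj h h')))

theorem qcommute_Kbar_F (hi : i ∈ Set.Icc 1 n) (hj : j ∈ Set.Ico 1 n) (h : i ≠ j)
    (h' : i ≠ j + 1) : QCommute (1 : Qv) (Kbar n i) (F n j) :=
  .of_eq (sub_eq_zero.1 (by simpa using proj_eq (.Kbar_F_far i j hi hj h h')))

theorem qcommute_Kbar_Ebar (hi : i ∈ Set.Icc 1 n) (hj : j ∈ Set.Ico 1 n) (h : i ≠ j)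
    (h' : i ≠ j + 1) : QCommute (-1 : Qv) (Kbar n i) (Ebar n j) :=
  .of_anti (eq_neg_of_add_eq_zero_left
    (by simpa using proj_eq (.Kbar_Ebar_far i j hi hj h h')))

theorem qcommute_Kbar_Fbar (hi : i ∈ Set.Icc 1 n) (hj : j ∈ Set.Ico 1 n) (h : i ≠ j)
    (h' : i ≠ j + 1) : QCommute (-1 : Qv) (Kbar n i) (Fbar n j) :=
  .of_anti (eq_neg_of_add_eq_zero_left
    (by simpa using proj_eq (.Kbar_Fbar_far i j hi hj h h')))

theorem E_F_commutator (hi : i ∈ Set.Ico 1 n) : E n i * F n i - F n i * E n i =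
    (v - v⁻¹)⁻¹ • (K n i * Kinv n (i + 1) - Kinv n i * K n (i + 1)) := by
  have := proj_eq (.E_F i i hi hi)
  rw [if_pos rfl] at this
  simpa only [map_sub, map_mul, map_smul] using! this

theorem E_Fbar_commutator (hi : i ∈ Set.Ico 1 n) : E n i * Fbar n i - Fbar n i * E n i =
    Kinv n (i + 1) * Kbar n i - Kbar n (i + 1) * Kinv n i := by
  have := proj_eq (.E_Fbar i i hi hi)
  rw [if_pos rfl] at this
  simpa only [map_sub, map_mul] using! this

theorem Ebar_F_commutator (hi : i ∈ Set.Ico 1 n) : Ebar n i * F n i - F n i * Ebar n i =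
    K n (i + 1) * Kbar n i - Kbar n (i + 1) * K n i := by
  have := proj_eq (.Ebar_F i i hi hi)
  rw [if_pos rfl] at this
  simpa only [map_sub, map_mul] using! this

theorem qcommute_E_F (hi : i ∈ Set.Ico 1 n) (hj : j ∈ Set.Ico 1 n) (h : i ≠ j) :
    QCommute (1 : Qv) (E n i) (F n j) := by
  have := proj_eq (.E_F i j hi hj)
  rw [if_neg h] at this
  exact .of_eq (sub_eq_zero.1 (by simpa using this))

theorem qcommute_E_Fbar (hi : i ∈ Set.Ico 1 n) (hj : j ∈ Set.Ico 1 n) (h : i ≠ j) :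
    QCommute (1 : Qv) (E n i) (Fbar n j) := by
  have := proj_eq (.E_Fbar i j hi hj)
  rw [if_neg h] at this
  exact .of_eq (sub_eq_zero.1 (by simpa using this))

theorem qcommute_Ebar_F (hi : i ∈ Set.Ico 1 n) (hj : j ∈ Set.Ico 1 n) (h : i ≠ j) :
    QCommute (1 : Qv) (Ebar n i) (F n j) := by
  have := proj_eq (.Ebar_F i j hi hj)
  rw [if_neg h] at this
  exact .of_eq (sub_eq_zero.1 (by simpa using this))

theorem qcommute_Ebar_Fbar (hi : i ∈ Set.Ico 1 n) (hj : j ∈ Set.Ico 1 n) (h : i ≠ j) :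
    QCommute (-1 : Qv) (Ebar n i) (Fbar n j) := by
  have := proj_eq (.Ebar_Fbar i j hi hj)
  rw [if_neg h] at this
  exact .of_anti (eq_neg_of_add_eq_zero_left (by simpa using this))

theorem qcommute_E_E (hi : i ∈ Set.Ico 1 n) (hj : j ∈ Set.Ico 1 n)
    (h : i + 1 < j ∨ j + 1 < i) : QCommute (1 : Qv) (E n i) (E n j) :=
  .of_eq (sub_eq_zero.1 (by simpa using proj_eq (.E_E_far i j hi hj h)))

theorem qcommute_F_F (hi : i ∈ Set.Ico 1 n) (hj : j ∈ Set.Ico 1 n)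
    (h : i + 1 < j ∨ j + 1 < i) : QCommute (1 : Qv) (F n i) (F n j) :=
  .of_eq (sub_eq_zero.1 (by simpa using proj_eq (.F_F_far i j hi hj h)))

theorem qcommute_E_Ebar (hi : i ∈ Set.Ico 1 n) (hj : j ∈ Set.Ico 1 n)
    (h : i + 1 < j ∨ j + 1 < i) : QCommute (1 : Qv) (E n i) (Ebar n j) :=
  .of_eq (sub_eq_zero.1 (by
    simpa using proj_eq (.E_Ebar_comm i j hi hj (by omega) (by omega))))

theorem qcommute_F_Fbar (hi : i ∈ Set.Ico 1 n) (hj : j ∈ Set.Ico 1 n)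
    (h : i + 1 < j ∨ j + 1 < i) : QCommute (1 : Qv) (F n i) (Fbar n j) :=
  .of_eq (sub_eq_zero.1 (by
    simpa using proj_eq (.F_Fbar_comm i j hi hj (by omega) (by omega))))

end Relations

/-! ### Root vectors as iterated brackets, and lifting of commutation from generators -/

section RootVectors

variable (n)

@[simp]
theorem rootE_succ (a : ℕ) : rootE n a (a + 1) = E n a := by
  simp [rootE, evenPos]

@[simp]
theorem rootEbar_succ (a : ℕ) : rootEbar n a (a + 1) = Ebar n a := by
  simp [rootEbar, oddPos]

@[simp]
theorem rootE_pred (a : ℕ) : rootE n (a + 1) a = F n a := by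
  simp [rootE, evenNeg]

@[simp]
theorem rootEbar_pred (a : ℕ) : rootEbar n (a + 1) a = Fbar n a := by
  simp [rootEbar, oddNeg]

theorem rootE_pos_succ (h : a < b) :
    rootE n a (b + 1) = qbr v⁻¹ (rootE n a b) (E n b) := by
  obtain ⟨d, rfl⟩ := Nat.exists_eq_add_of_lt h
  simp [rootE, qbr, h, show a < a + d + 1 + 1 by omega, show a + d + 1 + 1 - a - 1 = d + 1 by omega,
    show a + d + 1 - a - 1 = d by omega, evenPos]

theorem rootEbar_pos_succ (h : a < b) :
    rootEbar n a (b + 1) = qbr v⁻¹ (rootE n a b) (Ebar n b) := by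
  obtain ⟨d, rfl⟩ := Nat.exists_eq_add_of_lt h
  simp [rootE, rootEbar, qbr, h, show a < a + d + 1 + 1 by omega,
    show a + d + 1 + 1 - a - 1 = d + 1 by omega, show a + d + 1 - a - 1 = d by omega, oddPos]

theorem rootE_neg_succ (h : a < b) :
    rootE n (b + 1) a = qbr v (F n b) (rootE n b a) := by
  obtain ⟨d, rfl⟩ := Nat.exists_eq_add_of_lt h
  simp [rootE, qbr, h, h.not_gt, show a < a + d + 1 + 1 by omega,
    show ¬ a + d + 1 + 1 < a by omega, show a + d + 1 + 1 - a - 1 = d + 1 by omega,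
    show a + d + 1 - a - 1 = d by omega, evenNeg]

theorem rootEbar_neg_succ (h : a < b) :
    rootEbar n (b + 1) a = qbr v (Fbar n b) (rootE n b a) := by
  obtain ⟨d, rfl⟩ := Nat.exists_eq_add_of_lt h
  simp [rootE, rootEbar, qbr, h, h.not_gt, show a < a + d + 1 + 1 by omega,
    show ¬ a + d + 1 + 1 < a by omega, show a + d + 1 + 1 - a - 1 = d + 1 by omega,
    show a + d + 1 - a - 1 = d by omega, oddNeg]

end RootVectors

section Lift

variable {q : Qv} {y : U n}

theorem qcommute_rootE_pos (hab : a < b)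
    (h : ∀ m, a ≤ m → m < b → QCommute (1 : Qv) y (E n m)) :
    QCommute (1 : Qv) y (rootE n a b) := by
  induction b, hab using Nat.le_induction with
  | base => rw [rootE_succ]; exact h a le_rfl (Nat.lt_succ_self a)
  | succ b hb ih =>
    rw [rootE_pos_succ n hb]
    simpa only [mul_one] using
      (ih fun m h₁ h₂ => h m h₁ (by omega)).qbr_right v⁻¹ (h b (by omega) (by omega))

theorem qcommute_rootE_neg (hab : a < b)
    (h : ∀ m, a ≤ m → m < b → QCommute (1 : Qv) y (F n m)) :
    QCommute (1 : Qv) y (rootE n b a) := by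
  induction b, hab using Nat.le_induction with
  | base => rw [rootE_pred]; exact h a le_rfl (Nat.lt_succ_self a)
  | succ b hb ih =>
    rw [rootE_neg_succ n hb]
    simpa only [mul_one] using
      (h b (by omega) (by omega)).qbr_right v (ih fun m h₁ h₂ => h m h₁ (by omega))

/-- Only the last letter of an odd root vector is odd, so it alone determines the scalar. -/
theorem qcommute_rootEbar_pos (hab : a < b)
    (h : ∀ m, a ≤ m → m + 1 < b → QCommute (1 : Qv) y (E n m))
    (h' : QCommute q y (Ebar n (b - 1))) : QCommute q y (rootEbar n a b) := by
  obtain ⟨b, rfl⟩ : ∃ b', b = b' + 1 := ⟨b - 1, by omega⟩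
  obtain rfl | hab := (Nat.lt_succ_iff.1 hab).eq_or_lt
  · rw [rootEbar_succ]; exact h'
  · rw [rootEbar_pos_succ n hab]
    simpa only [one_mul, Nat.add_sub_cancel] using
      (qcommute_rootE_pos hab fun m h₁ h₂ => h m h₁ (by omega)).qbr_right v⁻¹ h'

theorem qcommute_rootEbar_neg (hab : a < b)
    (h : ∀ m, a ≤ m → m + 1 < b → QCommute (1 : Qv) y (F n m))
    (h' : QCommute q y (Fbar n (b - 1))) : QCommute q y (rootEbar n b a) := by
  obtain ⟨b, rfl⟩ : ∃ b', b = b' + 1 := ⟨b - 1, by omega⟩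
  obtain rfl | hab := (Nat.lt_succ_iff.1 hab).eq_or_lt
  · rw [rootEbar_pred]; exact h'
  · rw [rootEbar_neg_succ n hab]
    simpa only [mul_one, Nat.add_sub_cancel] using
      h'.qbr_right v (qcommute_rootE_neg hab fun m h₁ h₂ => h m h₁ (by omega))

end Lift

/-! ### Weights of root vectors -/

section Weights

/-- The pairing `(ε_i, ε_a - ε_b)`. -/
def weight (i a b : ℕ) : ℤ := (if i = a then 1 else 0) - (if i = b then 1 else 0)

theorem weight_add_pairing (i a b : ℕ) : weight i a b + pairing i b = weight i a (b + 1) := by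
  unfold weight pairing; ring

theorem v_zpow_weight_succ (i a b : ℕ) :
    v ^ weight i a b * v ^ pairing i b = v ^ weight i a (b + 1) := by
  rw [← zpow_add₀ v_ne_zero, weight_add_pairing]

theorem v_zpow_neg_weight_succ (i a b : ℕ) :
    v ^ (-pairing i b) * v ^ (-weight i a b) = v ^ (-weight i a (b + 1)) := by
  rw [← zpow_add₀ v_ne_zero, ← weight_add_pairing]; congr 1; ring

theorem qcommute_K_rootE_pos (hi : i ∈ Set.Icc 1 n) (ha : 1 ≤ a) (hab : a < b) (hb : b ≤ n) :
    QCommute (v ^ weight i a b) (K n i) (rootE n a b) := by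
  induction b, hab using Nat.le_induction with
  | base => rw [rootE_succ]; exact qcommute_K_E hi ⟨ha, hb⟩
  | succ b hab ih =>
    rw [rootE_pos_succ n hab, ← v_zpow_weight_succ]
    exact (ih (by omega)).qbr_right v⁻¹ (qcommute_K_E hi ⟨by omega, hb⟩)

theorem qcommute_K_rootE_neg (hi : i ∈ Set.Icc 1 n) (ha : 1 ≤ a) (hab : a < b) (hb : b ≤ n) :
    QCommute (v ^ (-weight i a b)) (K n i) (rootE n b a) := by
  induction b, hab using Nat.le_induction with
  | base => rw [rootE_pred]; exact qcommute_K_F hi ⟨ha, hb⟩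
  | succ b hab ih =>
    rw [rootE_neg_succ n hab, ← v_zpow_neg_weight_succ]
    exact (qcommute_K_F hi ⟨by omega, hb⟩).qbr_right v (ih (by omega))

theorem qcommute_K_rootEbar_pos (hi : i ∈ Set.Icc 1 n) (ha : 1 ≤ a) (hab : a < b)
    (hb : b ≤ n) : QCommute (v ^ weight i a b) (K n i) (rootEbar n a b) := by
  obtain ⟨b, rfl⟩ : ∃ b', b = b' + 1 := ⟨b - 1, by omega⟩
  obtain rfl | hab := (Nat.lt_succ_iff.1 hab).eq_or_lt
  · rw [rootEbar_succ]; exact qcommute_K_Ebar hi ⟨ha, hb⟩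
  · rw [rootEbar_pos_succ n hab, ← v_zpow_weight_succ]
    exact (qcommute_K_rootE_pos hi ha hab (by omega)).qbr_right v⁻¹
      (qcommute_K_Ebar hi ⟨by omega, hb⟩)

theorem qcommute_K_rootEbar_neg (hi : i ∈ Set.Icc 1 n) (ha : 1 ≤ a) (hab : a < b)
    (hb : b ≤ n) : QCommute (v ^ (-weight i a b)) (K n i) (rootEbar n b a) := by
  obtain ⟨b, rfl⟩ : ∃ b', b = b' + 1 := ⟨b - 1, by omega⟩
  obtain rfl | hab := (Nat.lt_succ_iff.1 hab).eq_or_lt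
  · rw [rootEbar_pred]; exact qcommute_K_Fbar hi ⟨ha, hb⟩
  · rw [rootEbar_neg_succ n hab, ← v_zpow_neg_weight_succ]
    exact (qcommute_K_Fbar hi ⟨by omega, hb⟩).qbr_right v
      (qcommute_K_rootE_neg hi ha hab (by omega))

theorem v_zpow_weight_left (h : a < b) : v ^ weight a a b = v := by
  simp [weight, h.ne]

theorem v_zpow_weight_right (h : a < b) : v ^ weight b a b = v⁻¹ := by
  simp [weight, h.ne']

theorem v_zpow_weight_of_ne (ha : i ≠ a) (hb : i ≠ b) : v ^ weight i a b = 1 := by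
  simp [weight, ha, hb]

theorem v_zpow_neg_weight_left (h : a < b) : v ^ (-weight a a b) = v⁻¹ := by
  simp [weight, h.ne]

theorem v_zpow_neg_weight_right (h : a < b) : v ^ (-weight b a b) = v := by
  simp [weight, h.ne']

theorem v_zpow_neg_weight_of_ne (ha : i ≠ a) (hb : i ≠ b) : v ^ (-weight i a b) = 1 := by
  simp [weight, ha, hb]

end Weights

/-! ### Commutation for disjoint index ranges -/

section Disjoint

theorem qcommute_E_rootE_neg (ha : 1 ≤ a) (hab : a < b) (hb : b ≤ n) (hm : m ∈ Set.Ico 1 n)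
    (h : m < a ∨ b ≤ m) : QCommute (1 : Qv) (E n m) (rootE n b a) :=
  qcommute_rootE_neg hab fun p h₁ h₂ => qcommute_E_F hm ⟨by omega, by omega⟩ (by omega)

theorem qcommute_Ebar_rootE_neg (ha : 1 ≤ a) (hab : a < b) (hb : b ≤ n)
    (hm : m ∈ Set.Ico 1 n) (h : m < a ∨ b ≤ m) : QCommute (1 : Qv) (Ebar n m) (rootE n b a) :=
  qcommute_rootE_neg hab fun p h₁ h₂ => qcommute_Ebar_F hm ⟨by omega, by omega⟩ (by omega)

theorem qcommute_E_rootEbar_neg (ha : 1 ≤ a) (hab : a < b) (hb : b ≤ n)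
    (hm : m ∈ Set.Ico 1 n) (h : m < a ∨ b ≤ m) :
    QCommute (1 : Qv) (E n m) (rootEbar n b a) :=
  qcommute_rootEbar_neg hab (fun p h₁ h₂ => qcommute_E_F hm ⟨by omega, by omega⟩ (by omega))
    (qcommute_E_Fbar hm ⟨by omega, by omega⟩ (by omega))

theorem qcommute_Ebar_rootEbar_neg (ha : 1 ≤ a) (hab : a < b) (hb : b ≤ n)
    (hm : m ∈ Set.Ico 1 n) (h : m < a ∨ b ≤ m) :
    QCommute (-1 : Qv) (Ebar n m) (rootEbar n b a) :=
  qcommute_rootEbar_neg hab (fun p h₁ h₂ => qcommute_Ebar_F hm ⟨by omega, by omega⟩ (by omega))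
    (qcommute_Ebar_Fbar hm ⟨by omega, by omega⟩ (by omega))

theorem qcommute_rootE_neg_rootE_pos (ha : 1 ≤ a) (hab : a < b) (hb : b ≤ n) (hk : 1 ≤ k)
    (hkl : k < l) (hl : l ≤ n) (h : b ≤ k ∨ l ≤ a) :
    QCommute (1 : Qv) (rootE n b a) (rootE n k l) :=
  qcommute_rootE_pos hkl fun m h₁ h₂ =>
    (qcommute_E_rootE_neg ha hab hb ⟨by omega, by omega⟩ (by omega)).symm_one

theorem qcommute_rootE_neg_rootEbar_pos (ha : 1 ≤ a) (hab : a < b) (hb : b ≤ n) (hk : 1 ≤ k)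
    (hkl : k < l) (hl : l ≤ n) (h : b ≤ k ∨ l ≤ a) :
    QCommute (1 : Qv) (rootE n b a) (rootEbar n k l) :=
  qcommute_rootEbar_pos hkl (fun m h₁ h₂ =>
    (qcommute_E_rootE_neg ha hab hb ⟨by omega, by omega⟩ (by omega)).symm_one)
    (qcommute_Ebar_rootE_neg ha hab hb ⟨by omega, by omega⟩ (by omega)).symm_one

theorem qcommute_rootEbar_neg_rootE_pos (ha : 1 ≤ a) (hab : a < b) (hb : b ≤ n) (hk : 1 ≤ k)
    (hkl : k < l) (hl : l ≤ n) (h : b ≤ k ∨ l ≤ a) :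
    QCommute (1 : Qv) (rootEbar n b a) (rootE n k l) :=
  qcommute_rootE_pos hkl fun m h₁ h₂ =>
    (qcommute_E_rootEbar_neg ha hab hb ⟨by omega, by omega⟩ (by omega)).symm_one

theorem qcommute_rootEbar_neg_rootEbar_pos (ha : 1 ≤ a) (hab : a < b) (hb : b ≤ n)
    (hk : 1 ≤ k) (hkl : k < l) (hl : l ≤ n) (h : b ≤ k ∨ l ≤ a) :
    QCommute (-1 : Qv) (rootEbar n b a) (rootEbar n k l) :=
  qcommute_rootEbar_pos hkl (fun m h₁ h₂ =>
    (qcommute_E_rootEbar_neg ha hab hb ⟨by omega, by omega⟩ (by omega)).symm_one)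
    (qcommute_Ebar_rootEbar_neg ha hab hb ⟨by omega, by omega⟩ (by omega)).symm_neg

theorem qcommute_rootE_pos_E (ha : 1 ≤ a) (hab : a < b) (hm : m < n) (h : b < m) :
    QCommute (1 : Qv) (rootE n a b) (E n m) :=
  (qcommute_rootE_pos hab fun p h₁ h₂ =>
    qcommute_E_E ⟨by omega, hm⟩ ⟨by omega, by omega⟩ (by omega)).symm_one

theorem qcommute_rootE_neg_F (ha : 1 ≤ a) (hab : a < b) (hm : m < n) (h : b < m) :
    QCommute (1 : Qv) (rootE n b a) (F n m) :=
  (qcommute_rootE_neg hab fun p h₁ h₂ =>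
    qcommute_F_F ⟨by omega, hm⟩ ⟨by omega, by omega⟩ (by omega)).symm_one

theorem qcommute_rootE_pos_Ebar (ha : 1 ≤ a) (hab : a < b) (hm : m < n) (h : b < m) :
    QCommute (1 : Qv) (rootE n a b) (Ebar n m) :=
  (qcommute_rootE_pos hab fun p h₁ h₂ =>
    .symm_one <| qcommute_E_Ebar ⟨by omega, by omega⟩ ⟨by omega, hm⟩ (by omega)).symm_one

theorem qcommute_rootE_neg_Fbar (ha : 1 ≤ a) (hab : a < b) (hm : m < n) (h : b < m) :
    QCommute (1 : Qv) (rootE n b a) (Fbar n m) :=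
  (qcommute_rootE_neg hab fun p h₁ h₂ =>
    .symm_one <| qcommute_F_Fbar ⟨by omega, by omega⟩ ⟨by omega, hm⟩ (by omega)).symm_one

theorem qcommute_Kbar_rootE_pos (hm : m ∈ Set.Icc 1 n) (ha : 1 ≤ a) (hab : a < b) (hb : b ≤ n)
    (h : m < a ∨ b < m) : QCommute (1 : Qv) (Kbar n m) (rootE n a b) :=
  qcommute_rootE_pos hab fun p h₁ h₂ =>
    qcommute_Kbar_E hm ⟨by omega, by omega⟩ (by omega) (by omega)

theorem qcommute_Kbar_rootE_neg (hm : m ∈ Set.Icc 1 n) (ha : 1 ≤ a) (hab : a < b) (hb : b ≤ n)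
    (h : m < a ∨ b < m) : QCommute (1 : Qv) (Kbar n m) (rootE n b a) :=
  qcommute_rootE_neg hab fun p h₁ h₂ =>
    qcommute_Kbar_F hm ⟨by omega, by omega⟩ (by omega) (by omega)

theorem qcommute_Kbar_rootEbar_pos (hm : m ∈ Set.Icc 1 n) (ha : 1 ≤ a) (hab : a < b)
    (hb : b ≤ n) (h : m < a ∨ b < m) : QCommute (-1 : Qv) (Kbar n m) (rootEbar n a b) :=
  qcommute_rootEbar_pos hab (fun p h₁ h₂ =>
    qcommute_Kbar_E hm ⟨by omega, by omega⟩ (by omega) (by omega))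
    (qcommute_Kbar_Ebar hm ⟨by omega, by omega⟩ (by omega) (by omega))

theorem qcommute_Kbar_rootEbar_neg (hm : m ∈ Set.Icc 1 n) (ha : 1 ≤ a) (hab : a < b)
    (hb : b ≤ n) (h : m < a ∨ b < m) : QCommute (-1 : Qv) (Kbar n m) (rootEbar n b a) :=
  qcommute_rootEbar_neg hab (fun p h₁ h₂ =>
    qcommute_Kbar_F hm ⟨by omega, by omega⟩ (by omega) (by omega))
    (qcommute_Kbar_Fbar hm ⟨by omega, by omega⟩ (by omega) (by omega))

end Disjoint

/-! ### Cutting root vectors at an intermediate index -/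

section Split

theorem rootE_pos_split (ha : 1 ≤ a) (hac : a < c) (hcb : c < b) (hb : b ≤ n) :
    rootE n a b = qbr v⁻¹ (rootE n a c) (rootE n c b) := by
  induction b, hcb using Nat.le_induction with
  | base => rw [rootE_pos_succ n hac, rootE_succ]
  | succ b hcb ih =>
    rw [rootE_pos_succ n (hac.trans hcb), rootE_pos_succ n hcb, ih (by omega)]
    exact qbr_assoc v⁻¹ _ (qcommute_rootE_pos_E ha hac hb hcb).eq

theorem rootEbar_pos_split (ha : 1 ≤ a) (hac : a < c) (hcb : c < b) (hb : b ≤ n) :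
    rootEbar n a b = qbr v⁻¹ (rootE n a c) (rootEbar n c b) := by
  obtain ⟨b, rfl⟩ : ∃ b', b = b' + 1 := ⟨b - 1, by omega⟩
  obtain rfl | hcb := (Nat.lt_succ_iff.1 hcb).eq_or_lt
  · rw [rootEbar_pos_succ n hac, rootEbar_succ]
  · rw [rootEbar_pos_succ n (hac.trans hcb), rootEbar_pos_succ n hcb,
      rootE_pos_split ha hac hcb (by omega)]
    exact qbr_assoc v⁻¹ _ (qcommute_rootE_pos_Ebar ha hac hb hcb).eq

theorem rootE_neg_split (ha : 1 ≤ a) (hac : a < c) (hcb : c < b) (hb : b ≤ n) :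
    rootE n b a = qbr v (rootE n b c) (rootE n c a) := by
  induction b, hcb using Nat.le_induction with
  | base => rw [rootE_neg_succ n hac, rootE_pred]
  | succ b hcb ih =>
    rw [rootE_neg_succ n (hac.trans hcb), rootE_neg_succ n hcb, ih (by omega)]
    exact (qbr_assoc v _ (qcommute_rootE_neg_F ha hac hb hcb).eq.symm).symm

theorem rootEbar_neg_split (ha : 1 ≤ a) (hac : a < c) (hcb : c < b) (hb : b ≤ n) :
    rootEbar n b a = qbr v (rootEbar n b c) (rootE n c a) := by
  obtain ⟨b, rfl⟩ : ∃ b', b = b' + 1 := ⟨b - 1, by omega⟩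
  obtain rfl | hcb := (Nat.lt_succ_iff.1 hcb).eq_or_lt
  · rw [rootEbar_neg_succ n hac, rootEbar_pred]
  · rw [rootEbar_neg_succ n (hac.trans hcb), rootEbar_neg_succ n hcb,
      rootE_neg_split ha hac hcb (by omega)]
    exact (qbr_assoc v _ (qcommute_rootE_neg_Fbar ha hac hb hcb).eq.symm).symm

end Split

/-! ### Exchange of even and odd root vectors by the odd Cartan element of the upper index -/

section Twisted

/-- In the bracket of `E_{a,b-1}` with the last generator, the first entry commutes with both `K̄_b`
and `K_b`, so the relation for the last generator passes through. -/
theorem Kbar_rootE_pos (ha : 1 ≤ a) (hab : a < b) (hb : b ≤ n) :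
    v • (Kbar n b * rootE n a b) + (-1 : Qv) • (rootE n a b * Kbar n b) =
      Kinv n b * -rootEbar n a b := by
  obtain ⟨b, rfl⟩ : ∃ b', b = b' + 1 := ⟨b - 1, by omega⟩
  have hE := Kbar_succ_E (n := n) (j := b) ⟨by omega, hb⟩
  obtain rfl | hab := (Nat.lt_succ_iff.1 hab).eq_or_lt
  · rw [rootE_succ, rootEbar_succ]; exact hE
  · have hK : b + 1 ∈ Set.Icc 1 n := ⟨by omega, hb⟩
    have h := twisted_qbr_left v⁻¹ v (-1)
      (qcommute_Kbar_rootE_pos hK ha hab (by omega) (by omega))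
      (QCommute.Kinv_left_one hK (v_zpow_weight_of_ne (i := b + 1) (a := a) (b := b) (by omega)
        (by omega) ▸ qcommute_K_rootE_pos hK ha hab (by omega))) hE
    have h' : qbr v⁻¹ (rootE n a b) (-Ebar n b) = -qbr v⁻¹ (rootE n a b) (Ebar n b) :=
      qbr_neg_right v⁻¹ (rootE n a b) (Ebar n b)
    rw [h', ← rootE_pos_succ n hab, ← rootEbar_pos_succ n hab] at h
    exact h

theorem Kbar_rootEbar_pos (ha : 1 ≤ a) (hab : a < b) (hb : b ≤ n) :
    v • (Kbar n b * rootEbar n a b) + (1 : Qv) • (rootEbar n a b * Kbar n b) =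
      Kinv n b * rootE n a b := by
  obtain ⟨b, rfl⟩ : ∃ b', b = b' + 1 := ⟨b - 1, by omega⟩
  have hE := Kbar_succ_Ebar (n := n) (j := b) ⟨by omega, hb⟩
  obtain rfl | hab := (Nat.lt_succ_iff.1 hab).eq_or_lt
  · rw [rootE_succ, rootEbar_succ]; exact hE
  · have hK : b + 1 ∈ Set.Icc 1 n := ⟨by omega, hb⟩
    rw [rootE_pos_succ n hab, rootEbar_pos_succ n hab]
    exact twisted_qbr_left v⁻¹ v 1
      (qcommute_Kbar_rootE_pos hK ha hab (by omega) (by omega))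
      (QCommute.Kinv_left_one hK (v_zpow_weight_of_ne (i := b + 1) (a := a) (b := b) (by omega)
        (by omega) ▸ qcommute_K_rootE_pos hK ha hab (by omega))) hE

theorem Kbar_rootE_neg (ha : 1 ≤ a) (hab : a < b) (hb : b ≤ n) :
    v • (Kbar n b * rootE n b a) + (-1 : Qv) • (rootE n b a * Kbar n b) =
      K n b * rootEbar n b a := by
  obtain ⟨b, rfl⟩ : ∃ b', b = b' + 1 := ⟨b - 1, by omega⟩
  have hE := Kbar_succ_F (n := n) (j := b) ⟨by omega, hb⟩
  obtain rfl | hab := (Nat.lt_succ_iff.1 hab).eq_or_lt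
  · rw [rootE_pred, rootEbar_pred]; exact hE
  · have hK : b + 1 ∈ Set.Icc 1 n := ⟨by omega, hb⟩
    rw [rootE_neg_succ n hab, rootEbar_neg_succ n hab]
    exact twisted_qbr_right v v (-1)
      (qcommute_Kbar_rootE_neg hK ha hab (by omega) (by omega))
      (v_zpow_neg_weight_of_ne (i := b + 1) (a := a) (b := b) (by omega)
        (by omega) ▸ qcommute_K_rootE_neg hK ha hab (by omega)) hE

theorem Kbar_rootEbar_neg (ha : 1 ≤ a) (hab : a < b) (hb : b ≤ n) :
    v • (Kbar n b * rootEbar n b a) + (1 : Qv) • (rootEbar n b a * Kbar n b) =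
      K n b * rootE n b a := by
  obtain ⟨b, rfl⟩ : ∃ b', b = b' + 1 := ⟨b - 1, by omega⟩
  have hE := Kbar_succ_Fbar (n := n) (j := b) ⟨by omega, hb⟩
  obtain rfl | hab := (Nat.lt_succ_iff.1 hab).eq_or_lt
  · rw [rootE_pred, rootEbar_pred]; exact hE
  · have hK : b + 1 ∈ Set.Icc 1 n := ⟨by omega, hb⟩
    rw [rootE_neg_succ n hab, rootEbar_neg_succ n hab]
    exact twisted_qbr_right v v 1
      (qcommute_Kbar_rootE_neg hK ha hab (by omega) (by omega))
      (v_zpow_neg_weight_of_ne (i := b + 1) (a := a) (b := b) (by omega)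
        (by omega) ▸ qcommute_K_rootE_neg hK ha hab (by omega)) hE

end Twisted

theorem sub_eq_sub_swap {A : Type*} [Ring A] {x y z w : A} (h : x - y = z - w) :
    y - x = w - z := by
  rw [← neg_sub x, h, neg_sub]

section OutsideWeights

theorem qcommute_K_rootE_pos_of_ne (hi : i ∈ Set.Icc 1 n) (ha : 1 ≤ a) (hab : a < b)
    (hb : b ≤ n) (hia : i ≠ a) (hib : i ≠ b) : QCommute (1 : Qv) (K n i) (rootE n a b) :=
  v_zpow_weight_of_ne hia hib ▸ qcommute_K_rootE_pos hi ha hab hb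

theorem qcommute_K_rootE_neg_of_ne (hi : i ∈ Set.Icc 1 n) (ha : 1 ≤ a) (hab : a < b)
    (hb : b ≤ n) (hia : i ≠ a) (hib : i ≠ b) : QCommute (1 : Qv) (K n i) (rootE n b a) :=
  v_zpow_neg_weight_of_ne hia hib ▸ qcommute_K_rootE_neg hi ha hab hb

theorem qcommute_K_rootEbar_pos_of_ne (hi : i ∈ Set.Icc 1 n) (ha : 1 ≤ a) (hab : a < b)
    (hb : b ≤ n) (hia : i ≠ a) (hib : i ≠ b) : QCommute (1 : Qv) (K n i) (rootEbar n a b) :=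
  v_zpow_weight_of_ne hia hib ▸ qcommute_K_rootEbar_pos hi ha hab hb

theorem qcommute_K_rootEbar_neg_of_ne (hi : i ∈ Set.Icc 1 n) (ha : 1 ≤ a) (hab : a < b)
    (hb : b ≤ n) (hia : i ≠ a) (hib : i ≠ b) : QCommute (1 : Qv) (K n i) (rootEbar n b a) :=
  v_zpow_neg_weight_of_ne hia hib ▸ qcommute_K_rootEbar_neg hi ha hab hb

end OutsideWeights

/-! ### Commutators of root vectors of opposite weights -/

section Commutators

/-- `phi` for the pair of root vectors `E_{i,c}`, `E_{c,i}`. -/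
def rootPhi (n i c : ℕ) (g : U n) : U n :=
  phi v (rootE n i c) (rootE n c i) (K n i * Kinv n c) (Kinv n i * K n c) g

theorem commutator_qbr_root {x y : U n} (hi : 1 ≤ i) (hic : i < c) (hc : c < n)
    (hef : rootE n i c * rootE n c i - rootE n c i * rootE n i c =
      (v - v⁻¹)⁻¹ • (K n i * Kinv n c - Kinv n i * K n c))
    (hx : QCommute (1 : Qv) x (rootE n i c)) (hy : QCommute (1 : Qv) y (rootE n c i))
    (hix : QCommute (1 : Qv) (K n i) x) (hiy : QCommute (1 : Qv) (K n i) y)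
    (hcx : QCommute v⁻¹ (K n c) x) (hcy : QCommute v (K n c) y) :
    qbr v x (rootE n c i) * qbr v⁻¹ (rootE n i c) y
      - qbr v⁻¹ (rootE n i c) y * qbr v x (rootE n c i) = rootPhi n i c (x * y - y * x) := by
  have hi' : i ∈ Set.Icc 1 n := ⟨hi, by omega⟩
  have hc' : c ∈ Set.Icc 1 n := ⟨by omega, hc.le⟩
  have v0 := v_ne_zero
  have v0' := inv_ne_zero v_ne_zero
  refine commutator_qbr v0 hx.eq hy.eq hef ?_ ?_ ?_ ?_
  · simpa only [one_mul, inv_inv] using hix.mul_left (hcx.Kinv_left v0' hc')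
  · simpa only [one_mul] using hiy.mul_left (hcy.Kinv_left v0 hc')
  · simpa only [one_mul] using (hix.Kinv_left_one hi').mul_left hcx
  · simpa only [one_mul] using (hiy.Kinv_left_one hi').mul_left hcy

theorem rootPhi_K (hi : 1 ≤ i) (hic : i < c) (hc : c < n)
    (hef : rootE n i c * rootE n c i - rootE n c i * rootE n i c =
      (v - v⁻¹)⁻¹ • (K n i * Kinv n c - Kinv n i * K n c)) : rootPhi n i c (K n c) = K n i := by
  have hi' : i ∈ Set.Icc 1 n := ⟨hi, by omega⟩
  have hc' : c ∈ Set.Icc 1 n := ⟨by omega, hc.le⟩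
  have h := phi_eq_mul_left v_ne_zero v_sub_inv_ne_zero hef
    (v_zpow_weight_right hic ▸ qcommute_K_rootE_pos hc' hi hic hc.le)
    (v_zpow_neg_weight_right hic ▸ qcommute_K_rootE_neg hc' hi hic hc.le)
  rw [← mul_assoc, (qcommute_K_K hc' hi').eq, mul_assoc, K_mul_Kinv hc', mul_one] at h
  exact h

theorem rootPhi_Kinv (hi : 1 ≤ i) (hic : i < c) (hc : c < n)
    (hef : rootE n i c * rootE n c i - rootE n c i * rootE n i c =
      (v - v⁻¹)⁻¹ • (K n i * Kinv n c - Kinv n i * K n c)) : rootPhi n i c (Kinv n c) = Kinv n i := by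
  have hi' : i ∈ Set.Icc 1 n := ⟨hi, by omega⟩
  have hc' : c ∈ Set.Icc 1 n := ⟨by omega, hc.le⟩
  have he := QCommute.Kinv_left (inv_ne_zero v_ne_zero) hc'
    (v_zpow_weight_right hic ▸ qcommute_K_rootE_pos hc' hi hic hc.le)
  have hf := QCommute.Kinv_left v_ne_zero hc'
    (v_zpow_neg_weight_right hic ▸ qcommute_K_rootE_neg hc' hi hic hc.le)
  rw [inv_inv] at he
  have h := phi_eq_mul_right v_ne_zero v_sub_inv_ne_zero hef he hf
  have hKK : QCommute (1 : Qv) (Kinv n i) (Kinv n c) :=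
    (((qcommute_K_K hc' hi').Kinv_left_one hc').symm_one).Kinv_left_one hi'
  rw [← mul_assoc, ← hKK.eq, mul_assoc, Kinv_mul_K hc', mul_one] at h
  exact h

theorem rootPhi_mul {y : U n} (g : U n) (he : QCommute (1 : Qv) y (rootE n i c))
    (hf : QCommute (1 : Qv) y (rootE n c i)) :
    rootPhi n i c (y * g) = y * rootPhi n i c g :=
  phi_mul v _ _ g he.eq hf.eq

theorem rootPhi_smul (a : Qv) (g : U n) : rootPhi n i c (a • g) = a • rootPhi n i c g :=
  phi_smul v _ _ _ _ a g

theorem rootPhi_sub (g g' : U n) :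
    rootPhi n i c (g - g') = rootPhi n i c g - rootPhi n i c g' :=
  phi_sub v _ _ _ _ g g'

/-- In the induction step, `[F_c, E_c]` is a combination of products of a Cartan element at `c + 1`
and one at `c`. The former pulls out of `rootPhi`, and the latter is moved to index `i`. -/
theorem rootE_commutator (hi : 1 ≤ i) (hij : i < j) (hj : j ≤ n) :
    rootE n i j * rootE n j i - rootE n j i * rootE n i j =
      (v - v⁻¹)⁻¹ • (K n i * Kinv n j - Kinv n i * K n j) := by
  induction j, hij using Nat.le_induction with
  | base => rw [rootE_succ, rootE_pred]; exact E_F_commutator ⟨hi, hj⟩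
  | succ c hic ih =>
    have hic : i < c := hic
    have hef := ih (by omega)
    have hi' : i ∈ Set.Icc 1 n := ⟨hi, by omega⟩
    have hc' : c ∈ Set.Icc 1 n := ⟨by omega, by omega⟩
    have hj' : c + 1 ∈ Set.Icc 1 n := ⟨by omega, hj⟩
    have hcc : c ∈ Set.Ico 1 n := ⟨by omega, hj⟩
    have hKe := qcommute_K_rootE_pos_of_ne hj' hi hic (by omega) (by omega) (by omega)
    have hKf := qcommute_K_rootE_neg_of_ne hj' hi hic (by omega) (by omega) (by omega)
    have h := commutator_qbr_root hi hic hj hef (x := F n c) (y := E n c)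
      (qcommute_rootE_pos hic fun m h₁ h₂ =>
        (qcommute_E_F ⟨by omega, by omega⟩ hcc (by omega)).symm_one)
      (qcommute_E_rootE_neg hi hic (by omega) hcc (by omega))
      (by simpa [pairing, show i ≠ c by omega, show i ≠ c + 1 by omega] using qcommute_K_F hi' hcc)
      (by simpa [pairing, show i ≠ c by omega, show i ≠ c + 1 by omega] using qcommute_K_E hi' hcc)
      (by simpa [pairing] using qcommute_K_F hc' hcc)
      (by simpa [pairing] using qcommute_K_E hc' hcc)
    have hg : F n c * E n c - E n c * F n c =
        (v - v⁻¹)⁻¹ • (K n (c + 1) * Kinv n c - Kinv n (c + 1) * K n c) := by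
      rw [(qcommute_K_K hj' hc').symm_one.Kinv_left_one hc' |>.symm_one.eq,
        ((qcommute_K_K hj' hc').Kinv_left_one hj').eq]
      refine sub_eq_sub_swap ?_ |>.trans (smul_sub _ _ _).symm
      rw [← smul_sub]
      exact E_F_commutator hcc
    rw [hg, rootPhi_smul, rootPhi_sub, rootPhi_mul _ hKe hKf, rootPhi_Kinv hi hic hj hef,
      rootPhi_mul _ (hKe.Kinv_left_one hj') (hKf.Kinv_left_one hj'), rootPhi_K hi hic hj hef,
      ← rootE_neg_succ n hic, ← rootE_pos_succ n hic] at h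
    rw [(qcommute_K_K hj' hi').symm_one.Kinv_left_one hi' |>.eq,
      ((qcommute_K_K hj' hi').Kinv_left_one hj').symm_one.eq, smul_sub]
    exact sub_eq_sub_swap (h.trans (smul_sub _ _ _))

/-- The commutators of an odd and an even root vector of opposite weights, up to an element which
behaves like an odd Cartan element of smaller index. -/
theorem exists_rootEbar_commutator (hi : 1 ≤ i) (hij : i < j) (hj : j ≤ n) :
    ∃ s : U n, QCommute (1 : Qv) (K n j) s ∧ QCommute (1 : Qv) (Kinv n j) s ∧
      QCommute (-1 : Qv) (Kbar n j) s ∧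
      (∀ l, j < l → l ≤ n → QCommute (-1 : Qv) (rootEbar n j l) s) ∧
      (∀ l, j < l → l ≤ n → QCommute (-1 : Qv) (rootEbar n l j) s) ∧
      rootEbar n j i * rootE n i j - rootE n i j * rootEbar n j i =
        Kbar n j * Kinv n i - Kinv n j * s ∧
      rootE n j i * rootEbar n i j - rootEbar n i j * rootE n j i =
        Kbar n j * K n i - K n j * s := by
  have hi' : i ∈ Set.Icc 1 n := ⟨hi, by omega⟩
  have hj' : j ∈ Set.Icc 1 n := ⟨by omega, hj⟩
  obtain ⟨c, rfl⟩ : ∃ c, j = c + 1 := ⟨j - 1, by omega⟩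
  obtain rfl | hic := (Nat.lt_succ_iff.1 hij).eq_or_lt
  -- For adjacent indices `s` is the odd Cartan element `K̄_i` itself.
  · refine ⟨Kbar n i, qcommute_K_Kbar hj' hi', (qcommute_K_Kbar hj' hi').Kinv_left_one hj',
      qcommute_Kbar_Kbar hj' hi' (by omega), fun l h₁ h₂ => ?_, fun l h₁ h₂ => ?_, ?_, ?_⟩
    · exact (qcommute_Kbar_rootEbar_pos hi' (by omega) h₁ h₂ (by omega)).symm_neg
    · exact (qcommute_Kbar_rootEbar_neg hi' (by omega) h₁ h₂ (by omega)).symm_neg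
    · rw [rootEbar_pred, rootE_succ]
      exact sub_eq_sub_swap (E_Fbar_commutator ⟨hi, hj⟩)
    · rw [rootEbar_succ, rootE_pred]
      exact sub_eq_sub_swap (Ebar_F_commutator ⟨hi, hj⟩)
  have hef := rootE_commutator hi hic (by omega : c ≤ n)
  have hc' : c ∈ Set.Icc 1 n := ⟨by omega, by omega⟩
  have hcc : c ∈ Set.Ico 1 n := ⟨by omega, hj⟩
  have hKe := qcommute_K_rootE_pos_of_ne hj' hi hic (by omega) (by omega) (by omega)
  have hKf := qcommute_K_rootE_neg_of_ne hj' hi hic (by omega) (by omega) (by omega)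
  have hBe := qcommute_Kbar_rootE_pos hj' hi hic (by omega) (by omega)
  have hBf := qcommute_Kbar_rootE_neg hj' hi hic (by omega) (by omega)
  -- An element commuting with all other ingredients of `rootPhi` has the same scalar against `s` as
  -- against `K̄_c`, so `s` itself is never expanded.
  have lift {q : Qv} {y : U n} (he : QCommute (1 : Qv) y (rootE n i c))
      (hf : QCommute (1 : Qv) y (rootE n c i)) (h₁ : QCommute (1 : Qv) (K n i) y)
      (h₂ : QCommute (1 : Qv) (K n c) y) (hB : QCommute q y (Kbar n c)) :
      QCommute q y (rootPhi n i c (Kbar n c)) :=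
    QCommute.phi_right he hf
      (by simpa only [mul_one] using h₁.symm_one.mul_right (h₂.Kinv_left_one hc').symm_one)
      (by simpa only [mul_one] using (h₁.Kinv_left_one hi').symm_one.mul_right h₂.symm_one) hB
  have hKs : QCommute (1 : Qv) (K n (c + 1)) (rootPhi n i c (Kbar n c)) :=
    lift hKe hKf (qcommute_K_K hi' hj') (qcommute_K_K hc' hj') (qcommute_K_Kbar hj' hc')
  refine ⟨rootPhi n i c (Kbar n c), hKs, hKs.Kinv_left_one hj', ?_, fun l h₁ h₂ => ?_,
    fun l h₁ h₂ => ?_, ?_, ?_⟩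
  · exact lift hBe hBf (qcommute_K_Kbar hi' hj') (qcommute_K_Kbar hc' hj')
      (qcommute_Kbar_Kbar hj' hc' (by omega))
  · exact lift
      (qcommute_rootE_pos hic fun m h₃ h₄ => (qcommute_rootEbar_pos h₁ (fun p h₅ h₆ =>
        qcommute_E_E ⟨by omega, by omega⟩ ⟨by omega, by omega⟩ (by omega))
        (qcommute_E_Ebar ⟨by omega, by omega⟩ ⟨by omega, by omega⟩ (by omega))).symm_one)
      (qcommute_rootE_neg_rootEbar_pos hi hic (by omega) (by omega) h₁ h₂ (by omega)).symm_one
      (qcommute_K_rootEbar_pos_of_ne hi' (by omega) h₁ h₂ (by omega) (by omega))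
      (qcommute_K_rootEbar_pos_of_ne hc' (by omega) h₁ h₂ (by omega) (by omega))
      (qcommute_Kbar_rootEbar_pos hc' (by omega) h₁ h₂ (by omega)).symm_neg
  · exact lift
      (qcommute_rootEbar_neg_rootE_pos (by omega) h₁ h₂ hi hic (by omega) (by omega))
      (qcommute_rootE_neg hic fun m h₃ h₄ => (qcommute_rootEbar_neg h₁ (fun p h₅ h₆ =>
        qcommute_F_F ⟨by omega, by omega⟩ ⟨by omega, by omega⟩ (by omega))
        (qcommute_F_Fbar ⟨by omega, by omega⟩ ⟨by omega, by omega⟩ (by omega))).symm_one)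
      (qcommute_K_rootEbar_neg_of_ne hi' (by omega) h₁ h₂ (by omega) (by omega))
      (qcommute_K_rootEbar_neg_of_ne hc' (by omega) h₁ h₂ (by omega) (by omega))
      (qcommute_Kbar_rootEbar_neg hc' (by omega) h₁ h₂ (by omega)).symm_neg
  · have h := commutator_qbr_root hi hic hj hef (x := Fbar n c) (y := E n c)
      (qcommute_rootE_pos hic fun m h₁ h₂ =>
        (qcommute_E_Fbar ⟨by omega, by omega⟩ hcc (by omega)).symm_one)
      (qcommute_E_rootE_neg hi hic (by omega) hcc (by omega))
      (by simpa [pairing, show i ≠ c by omega, show i ≠ c + 1 by omega] using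
        qcommute_K_Fbar hi' hcc)
      (by simpa [pairing, show i ≠ c by omega, show i ≠ c + 1 by omega] using qcommute_K_E hi' hcc)
      (by simpa [pairing] using qcommute_K_Fbar hc' hcc)
      (by simpa [pairing] using qcommute_K_E hc' hcc)
    rw [sub_eq_sub_swap (E_Fbar_commutator hcc), rootPhi_sub, rootPhi_mul _ hBe hBf,
      rootPhi_Kinv hi hic hj hef, rootPhi_mul _ (hKe.Kinv_left_one hj') (hKf.Kinv_left_one hj'),
      ← rootEbar_neg_succ n hic, ← rootE_pos_succ n hic] at h
    exact h
  · have h := commutator_qbr_root hi hic hj hef (x := F n c) (y := Ebar n c)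
      (qcommute_rootE_pos hic fun m h₁ h₂ =>
        (qcommute_E_F ⟨by omega, by omega⟩ hcc (by omega)).symm_one)
      (qcommute_Ebar_rootE_neg hi hic (by omega) hcc (by omega))
      (by simpa [pairing, show i ≠ c by omega, show i ≠ c + 1 by omega] using qcommute_K_F hi' hcc)
      (by simpa [pairing, show i ≠ c by omega, show i ≠ c + 1 by omega] using
        qcommute_K_Ebar hi' hcc)
      (by simpa [pairing] using qcommute_K_F hc' hcc)
      (by simpa [pairing] using qcommute_K_Ebar hc' hcc)
    rw [sub_eq_sub_swap (Ebar_F_commutator hcc), rootPhi_sub, rootPhi_mul _ hBe hBf,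
      rootPhi_K hi hic hj hef, rootPhi_mul _ hKe hKf,
      ← rootE_neg_succ n hic, ← rootEbar_pos_succ n hic] at h
    exact h

end Commutators

/-! ### Nested index ranges -/

section Nested

theorem rootE_neg_split_mid (hi : 1 ≤ i) (him : i < m) (hmj : m + 1 < j) (hj : j ≤ n) :
    rootE n j i = qbr v (rootE n j (m + 1)) (qbr v (F n m) (rootE n m i)) := by
  rw [rootE_neg_split hi (by omega : i < m + 1) hmj hj, rootE_neg_succ n him]

theorem rootE_neg_comm (hi : 1 ≤ i) (him : i < m) (hmj : m + 1 < j) (hj : j ≤ n) :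
    rootE n j (m + 1) * rootE n m i = rootE n m i * rootE n j (m + 1) :=
  (qcommute_rootE_neg him fun p h₁ h₂ => (qcommute_rootE_neg hmj fun r h₃ h₄ =>
    qcommute_F_F ⟨by omega, by omega⟩ ⟨by omega, by omega⟩ (by omega)).symm_one).eq (k := Qv)

/-- Only the letter `F_m` fails to commute with `E_m`. Of the two Cartan terms it yields, one is
annihilated by bracketing with `E_{j,m+1}`, the other with `E_{m,i}`. -/
theorem qcommute_E_rootE_neg_nested (hi : 1 ≤ i) (him : i < m) (hmj : m + 1 < j) (hj : j ≤ n) :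
    QCommute (1 : Qv) (E n m) (rootE n j i) := by
  have hm : m ∈ Set.Icc 1 n := ⟨by omega, by omega⟩
  have hm' : m + 1 ∈ Set.Icc 1 n := ⟨by omega, by omega⟩
  have hmm : m ∈ Set.Ico 1 n := ⟨by omega, by omega⟩
  rw [rootE_neg_split_mid hi him hmj hj]
  -- The sign appears because the term annihilated by the left factor has to be listed first.
  refine QCommute.qbr_qbr (a := -(v - v⁻¹)⁻¹) (w₁ := Kinv n m * K n (m + 1))
    (w₂ := K n m * Kinv n (m + 1))
    (qcommute_E_rootE_neg hi him (by omega) hmm (by omega))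
    (qcommute_E_rootE_neg (by omega) hmj hj hmm (by omega)) (rootE_neg_comm hi him hmj hj)
    ((E_F_commutator hmm).trans (smul_sub_eq_neg_smul_sub _ _ _)) ?_ ?_
  · have h₁ := qcommute_K_rootE_neg_of_ne hm (by omega) hmj hj (by omega) (by omega)
    have h₂ := qcommute_K_rootE_neg hm' (by omega) hmj hj
    rw [v_zpow_neg_weight_left hmj] at h₂
    simpa only [one_mul, inv_inv] using
      ((h₁.Kinv_left_one hm).mul_left h₂).flip (by simpa using v_ne_zero)
  · have h₁ := qcommute_K_rootE_neg hm hi him (by omega)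
    have h₂ := qcommute_K_rootE_neg_of_ne hm' hi him (by omega) (by omega) (by omega)
    rw [v_zpow_neg_weight_right him] at h₁
    simpa only [mul_one] using h₁.mul_left (h₂.Kinv_left_one hm')

theorem qcommute_Ebar_rootE_neg_nested (hi : 1 ≤ i) (him : i < m) (hmj : m + 1 < j)
    (hj : j ≤ n) : QCommute (1 : Qv) (Ebar n m) (rootE n j i) := by
  have hm : m ∈ Set.Icc 1 n := ⟨by omega, by omega⟩
  have hm' : m + 1 ∈ Set.Icc 1 n := ⟨by omega, by omega⟩
  have hmm : m ∈ Set.Ico 1 n := ⟨by omega, by omega⟩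
  rw [rootE_neg_split_mid hi him hmj hj]
  refine QCommute.qbr_qbr (a := 1) (w₁ := K n (m + 1) * Kbar n m)
    (w₂ := Kbar n (m + 1) * K n m)
    (qcommute_Ebar_rootE_neg hi him (by omega) hmm (by omega))
    (qcommute_Ebar_rootE_neg (by omega) hmj hj hmm (by omega)) (rootE_neg_comm hi him hmj hj)
    ((Ebar_F_commutator hmm).trans (one_smul Qv _).symm) ?_ ?_
  · have h₁ := qcommute_Kbar_rootE_neg hm (by omega) hmj hj (by omega)
    have h₂ := qcommute_K_rootE_neg hm' (by omega) hmj hj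
    rw [v_zpow_neg_weight_left hmj] at h₂
    simpa only [mul_one, inv_inv] using (h₂.mul_left h₁).flip (by simpa using v_ne_zero)
  · have h₁ := qcommute_K_rootE_neg hm hi him (by omega)
    have h₂ := qcommute_Kbar_rootE_neg hm' hi him (by omega) (by omega)
    rw [v_zpow_neg_weight_right him] at h₁
    simpa only [one_mul] using h₂.mul_left h₁

/-- `Ē_{j,i}` is recovered from `E_{j,i}` by `K̄_j` and `K_j⁻¹`, which commute with `E_m` because `m
+ 1 < j`. -/
theorem qcommute_E_rootEbar_neg_nested (hi : 1 ≤ i) (him : i < m) (hmj : m + 1 < j)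
    (hj : j ≤ n) : QCommute (1 : Qv) (E n m) (rootEbar n j i) := by
  have hj' : j ∈ Set.Icc 1 n := ⟨by omega, hj⟩
  have hmm : m ∈ Set.Ico 1 n := ⟨by omega, by omega⟩
  have hK := qcommute_K_E hj' hmm
  rw [show pairing j m = 0 by simp [pairing]; omega, zpow_zero] at hK
  exact .of_twisted (Kinv_mul_K hj') (qcommute_Kbar_E hj' hmm (by omega) (by omega)).symm_one
    (qcommute_E_rootE_neg_nested hi him hmj hj) (hK.Kinv_left_one hj').symm_one
    (Kbar_rootE_neg hi (by omega) hj)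

theorem qcommute_Ebar_rootEbar_neg_nested (hi : 1 ≤ i) (him : i < m) (hmj : m + 1 < j)
    (hj : j ≤ n) : QCommute (-1 : Qv) (Ebar n m) (rootEbar n j i) := by
  have hj' : j ∈ Set.Icc 1 n := ⟨by omega, hj⟩
  have hmm : m ∈ Set.Ico 1 n := ⟨by omega, by omega⟩
  have hK := qcommute_K_Ebar hj' hmm
  rw [show pairing j m = 0 by simp [pairing]; omega, zpow_zero] at hK
  exact .of_twisted (Kinv_mul_K hj') (qcommute_Kbar_Ebar hj' hmm (by omega) (by omega)).symm_neg
    (qcommute_Ebar_rootE_neg_nested hi him hmj hj) (hK.Kinv_left_one hj').symm_one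
    (Kbar_rootE_neg hi (by omega) hj)

theorem qcommute_rootEbar_nested (hi : 1 ≤ i) (hik : i < k) (hkl : k < l) (hlj : l < j)
    (hj : j ≤ n) : QCommute (-1 : Qv) (rootEbar n j i) (rootEbar n k l) :=
  qcommute_rootEbar_pos hkl (fun m h₁ h₂ =>
    (qcommute_E_rootEbar_neg_nested hi (by omega) (by omega) hj).symm_one)
    (qcommute_Ebar_rootEbar_neg_nested hi (by omega) (by omega) hj).symm_neg

end Nested

/-! ### Overlapping index ranges -/

section Overlapping

/-- The scalar `-v` is the one at which the `s` term drops out of `mul_qbr_eq` for `q = v⁻¹`. -/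
theorem qcommute_Kinv_mul_rootEbar_pos {s : U n} (hj : 1 ≤ j) (hjl : j < l) (hl : l ≤ n)
    (hs : QCommute (-1 : Qv) (rootEbar n j l) s) :
    QCommute (v * -1) (rootEbar n j l) (Kinv n j * s) := by
  have hj' : j ∈ Set.Icc 1 n := ⟨hj, by omega⟩
  have h := qcommute_K_rootEbar_pos hj' hj hjl hl
  rw [v_zpow_weight_left hjl] at h
  have h' := (h.Kinv_left v_ne_zero hj').flip (inv_ne_zero v_ne_zero)
  rw [inv_inv] at h'
  exact h'.mul_right hs

/-- Cut `Ē_{i,l}` at `j`. Its odd part `Ē_{j,l}` anticommutes with `Ē_{j,i}`, so only the commutator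
of `Ē_{j,i}` with `E_{i,j}` contributes. -/
theorem rootEbar_mul_same_left (hi : 1 ≤ i) (hij : i < j) (hjl : j < l) (hl : l ≤ n) :
    rootEbar n j i * rootEbar n i l =
      -(rootEbar n i l * rootEbar n j i) - Kbar n j * rootEbar n j l * Kinv n i
        - v⁻¹ • (rootEbar n j l * Kbar n j * Kinv n i) := by
  have hi' : i ∈ Set.Icc 1 n := ⟨hi, by omega⟩
  obtain ⟨s, -, -, -, hs, -, hg, -⟩ := exists_rootEbar_commutator (n := n) hi hij (by omega)
  have hw := (qcommute_K_rootEbar_pos_of_ne hi' (by omega) hjl hl (by omega)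
    (by omega)).Kinv_left_one hi'
  have h := mul_qbr_eq (inv_ne_zero v_ne_zero)
    (qcommute_rootEbar_neg_rootEbar_pos hi hij (by omega) (by omega) hjl hl (.inl le_rfl)) hg
    (by
      rw [inv_inv, mul_comm]
      exact qcommute_Kinv_mul_rootEbar_pos (by omega) hjl hl (hs l hjl hl))
  rw [← rootEbar_pos_split hi hij hjl hl, mul_assoc (Kbar n j), hw.eq, ← mul_assoc, ← mul_assoc]
    at h
  exact h

/-- The mirror argument: the negative vector `Ē_{j,i}` is the one cut, at `l`. -/
theorem rootEbar_mul_same_left_gt (hi : 1 ≤ i) (hil : i < l) (hlj : l < j) (hj : j ≤ n) :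
    rootEbar n j i * rootEbar n i l =
      -(rootEbar n i l * rootEbar n j i) - rootEbar n j l * Kbar n l * K n i
        - v • (Kbar n l * rootEbar n j l * K n i) := by
  have hi' : i ∈ Set.Icc 1 n := ⟨hi, by omega⟩
  have hl' : l ∈ Set.Icc 1 n := ⟨by omega, by omega⟩
  obtain ⟨s, -, -, -, -, hs, -, hg⟩ := exists_rootEbar_commutator (n := n) hi hil (by omega)
  have hw := qcommute_K_rootEbar_neg_of_ne hi' (by omega) hlj hj (by omega) (by omega)
  have hKl := qcommute_K_rootEbar_neg hl' (by omega) hlj hj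
  rw [v_zpow_neg_weight_left hlj] at hKl
  have hKl' := hKl.flip (inv_ne_zero v_ne_zero)
  rw [inv_inv] at hKl'
  have h := qbr_mul_eq
    (qcommute_rootEbar_neg_rootEbar_pos (by omega) hlj hj hi hil (by omega) (.inr le_rfl)) hg
    (by
      rw [mul_comm]
      exact hKl'.mul_right (hs j hlj hj))
  rw [← rootEbar_neg_split hi hil hlj hj, mul_assoc (Kbar n l) (K n i), hw.eq, ← mul_assoc,
    ← mul_assoc] at h
  exact h

theorem rootEbar_mul_crossing (hi : 1 ≤ i) (hik : i < k) (hkj : k < j) (hjl : j < l)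
    (hl : l ≤ n) :
    rootEbar n j i * rootEbar n k l =
      -(rootEbar n k l * rootEbar n j i)
        - (v - v⁻¹) • (Kbar n j * rootEbar n j l * rootE n k i * Kinv n k)
        - (v⁻¹ * (v - v⁻¹)) • (rootE n k i * rootEbar n j l * Kbar n j * Kinv n k) := by
  have hk' : k ∈ Set.Icc 1 n := ⟨by omega, by omega⟩
  have hj' : j ∈ Set.Icc 1 n := ⟨by omega, by omega⟩
  have v0 := inv_ne_zero v_ne_zero
  obtain ⟨s, -, -, -, hs, -, hg, -⟩ := exists_rootEbar_commutator (n := n)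
    (by omega : 1 ≤ k) hkj (by omega)
  have hxe := qcommute_rootE_neg_rootE_pos hi hik (by omega : k ≤ n) (by omega) hkj (by omega)
    (.inl le_rfl)
  have hxW := qcommute_rootE_neg_rootEbar_pos hi hik (by omega : k ≤ n) (by omega) hjl hl
    (by omega)
  have hBx := qcommute_Kbar_rootE_neg hj' hi hik (by omega : k ≤ n) (by omega)
  have hKW := (qcommute_K_rootEbar_pos_of_ne hk' (by omega) hjl hl (by omega)
    (by omega)).Kinv_left_one hk'
  have hKx := qcommute_K_rootE_neg hk' hi hik (by omega)
  rw [v_zpow_neg_weight_right hik] at hKx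
  have hp := hBx.mul_left (hKx.Kinv_left v_ne_zero hk')
  rw [one_mul] at hp
  -- Cutting `Ē_{j,i}` at `k` reduces to the opposite pair on `k`, `j`. Bracketing `K̄_j K_k⁻¹` with
  -- `E_{k,i}` gives `v - v⁻¹`, since their scalar is `v⁻¹`; the `s` part is left for `mul_qbr_eq`
  -- to remove.
  have hg' : rootEbar n j i * rootE n k j - rootE n k j * rootEbar n j i =
      (v - v⁻¹) • (rootE n k i * (Kbar n j * Kinv n k)) - qbr v (Kinv n j * s) (rootE n k i) := by
    rw [rootEbar_neg_split hi hik hkj (by omega), ← qbr_eq_smul hp, ← qbr_sub_left, ← hg]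
    exact qbr_commutator_left v hxe
  have hr := (qcommute_Kinv_mul_rootEbar_pos (by omega) hjl hl (hs l hjl hl)).qbr_right v
    hxW.symm_one
  have h := mul_qbr_eq v0
    (qcommute_rootEbar_neg_rootEbar_pos hi (by omega) (by omega) (by omega) hjl hl (.inl le_rfl))
    hg' (by rw [inv_inv, mul_comm]; simpa only [mul_one] using hr)
  rw [← rootEbar_pos_split (by omega) hkj hjl hl] at h
  have e₁ : rootE n k i * (Kbar n j * Kinv n k) * rootEbar n j l =
      Kbar n j * rootEbar n j l * rootE n k i * Kinv n k := by
    rw [mul_assoc, mul_assoc (Kbar n j), hKW.eq, ← mul_assoc, ← hBx.eq, ← mul_assoc,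
      mul_assoc (Kbar n j), hxW.eq, ← mul_assoc]
  have e₂ : rootEbar n j l * (rootE n k i * (Kbar n j * Kinv n k)) =
      rootE n k i * rootEbar n j l * Kbar n j * Kinv n k := by
    rw [hxW.eq, ← mul_assoc, ← mul_assoc]
  rw [smul_mul_assoc, mul_smul_comm, e₁, e₂, smul_smul] at h
  exact h

theorem rootEbar_mul_same_right (hi : 1 ≤ i) (hik : i < k) (hkj : k < j) (hj : j ≤ n) :
    rootEbar n j i * rootEbar n k j =
      -(rootEbar n k j * rootEbar n j i) - rootE n k i * Kinv n k * Kinv n j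
        - (v - v⁻¹) • ((rootE n j i * rootEbar n k j - rootEbar n k j * rootE n j i)
          * Kinv n j * Kbar n j) := by
  have hij : i < j := by omega
  have hk' : k ∈ Set.Icc 1 n := ⟨by omega, by omega⟩
  have hj' : j ∈ Set.Icc 1 n := ⟨by omega, by omega⟩
  obtain ⟨s, hKs, hKs', hBs, -, -, -, hg⟩ := exists_rootEbar_commutator (n := n)
    (by omega : 1 ≤ k) hkj (by omega)
  have hxe := qcommute_rootE_neg_rootE_pos hi hik (by omega : k ≤ n) (by omega) hkj (by omega)
    (.inl le_rfl)
  have hxe' := qcommute_rootE_neg_rootEbar_pos hi hik (by omega : k ≤ n) (by omega) hkj (by omega)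
    (.inl le_rfl)
  have hBx := qcommute_Kbar_rootE_neg hj' hi hik (by omega : k ≤ n) (by omega)
  have hKjx := (qcommute_K_rootE_neg_of_ne hj' hi hik (by omega) (by omega) (by omega))
  have hKx := qcommute_K_rootE_neg hk' hi hik (by omega)
  rw [v_zpow_neg_weight_right hik] at hKx
  have hp := hBx.mul_left hKx
  rw [one_mul] at hp
  have hsplit := rootE_neg_split hi hik hkj hj
  have hg' : rootE n j i * rootEbar n k j - rootEbar n k j * rootE n j i =
      qbr v (Kbar n j * K n k - K n j * s) (rootE n k i) := by
    rw [hsplit, ← hg]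
    exact qbr_commutator_left v hxe'
  have hKK := (qcommute_K_K hj' hj').Kinv_left_one hj'
  -- Bracketing with `E_{k,i}` annihilates `K̄_j K_k`, the only part that would not anticommute with
  -- `K̄_j`.
  have hBr : QCommute (-1 : Qv) (Kbar n j) (qbr v (Kbar n j * K n k - K n j * s) (rootE n k i)) := by
    have := QCommute.qbr_sub_right hp ((qcommute_K_Kbar hj' hj').symm_one.mul_right hBs) hBx
    simpa only [one_mul, mul_one] using this
  have hKr : QCommute (1 : Qv) (Kinv n j)
      (qbr v (Kbar n j * K n k - K n j * s) (rootE n k i)) := by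
    have := QCommute.qbr_sub_right hp (hKK.mul_right hKs') (hKjx.Kinv_left_one hj')
    simpa only [one_mul, mul_one] using this
  have hf := qcommute_K_rootE_neg hj' hi hij hj
  rw [v_zpow_neg_weight_right hij] at hf
  have he := qcommute_K_rootEbar_pos hj' (by omega) hkj hj
  rw [v_zpow_weight_right hkj] at he
  have he' := he.Kinv_left (inv_ne_zero v_ne_zero) hj'
  rw [inv_inv] at he'
  have h := anticommutator_of_twisted_neg v_ne_zero (Kinv_mul_K hj') (hf.Kinv_left v_ne_zero hj')
    he' (Kbar_rootE_neg hi hij hj) (Kbar_rootEbar_pos (by omega) hkj hj) (hg' ▸ hBr) (hg' ▸ hKr)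
  have hq : QCommute v (K n k * Kinv n j) (rootE n k i) := by
    simpa only [mul_one] using hKx.mul_left (hKjx.Kinv_left_one hj')
  have hq' : QCommute v⁻¹ (Kinv n k * K n j) (rootE n k i) := by
    simpa only [mul_one] using (hKx.Kinv_left v_ne_zero hk').mul_left hKjx
  -- Of the two Cartan terms of the `k`, `j` pair, `K_k K_j⁻¹` is annihilated by the bracket with
  -- `E_{k,i}`. The other acquires `v - v⁻¹`, which cancels the denominator.
  have hfe : rootE n j i * rootE n k j - rootE n k j * rootE n j i =
      rootE n k i * (Kinv n k * K n j) := by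
    have h₁ := sub_eq_sub_swap ((rootE_commutator (n := n) (by omega : 1 ≤ k) hkj hj).trans
      (smul_sub _ _ _))
    rw [← smul_sub] at h₁
    rw [hsplit]
    refine (qbr_commutator_left v hxe).trans ?_
    have h₂ := qbr_smul_sub_left v (v - v⁻¹)⁻¹ (Kinv n k * K n j) (K n k * Kinv n j) (rootE n k i)
    rw [qbr_eq_smul hq, sub_self, zero_smul, sub_zero, qbr_eq_smul hq', smul_smul,
      inv_mul_cancel₀ v_sub_inv_ne_zero, one_smul] at h₂
    rw [h₁]
    exact h₂
  have hcart : Kinv n j * Kinv n j * (rootE n k i * (Kinv n k * K n j)) =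
      rootE n k i * Kinv n k * Kinv n j := by
    have hKK' := ((qcommute_K_K hk' hj').Kinv_left_one hk').symm_one.Kinv_left_one hj'
    have hx := hKjx.Kinv_left_one hj'
    rw [← mul_assoc (rootE n k i), mul_assoc (Kinv n j), ← mul_assoc (Kinv n j) (_ * _),
      ← mul_assoc (Kinv n j) (rootE n k i), hx.eq, mul_assoc (rootE n k i) (Kinv n j), hKK'.eq,
      ← mul_assoc (rootE n k i), mul_assoc _ (Kinv n j) (K n j), Kinv_mul_K hj', mul_one,
      ← mul_assoc, hx.eq, mul_assoc, hKK'.eq, ← mul_assoc]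
  rw [hfe, hcart] at h
  exact h

theorem rootEbar_mul_opposite (hi : 1 ≤ i) (hij : i < j) (hj : j ≤ n) :
    rootEbar n j i * rootEbar n i j =
      -(rootEbar n i j * rootEbar n j i)
        + (v - v⁻¹)⁻¹ • (K n j * K n i - Kinv n i * Kinv n j)
        + (v - v⁻¹) • (Kbar n j ^ 2 * Kinv n i * K n j)
        - (v - v⁻¹) • ((rootEbar n j i * rootE n i j - rootE n i j * rootEbar n j i)
            * K n j * Kbar n j) := by
  have hi' : i ∈ Set.Icc 1 n := ⟨hi, by omega⟩
  have hj' : j ∈ Set.Icc 1 n := ⟨by omega, by omega⟩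
  obtain ⟨s, hKs, hKs', hBs, -, -, hg, -⟩ := exists_rootEbar_commutator hi hij hj
  have he := qcommute_K_rootE_pos hj' hi hij hj
  rw [v_zpow_weight_right hij] at he
  have hf := qcommute_K_rootEbar_neg hj' hi hij hj
  rw [v_zpow_neg_weight_right hij] at hf
  have hB := qcommute_K_Kbar hj' hj'
  have hKK := (qcommute_K_K hi' hj').Kinv_left_one hi'
  exact anticommutator_of_opposite v_ne_zero v_sq_sub_inv_sq_ne_zero (K_mul_Kinv hj') he hf
    (Kbar_rootE_pos hi hij hj) (Kbar_rootEbar_neg hi hij hj) (rootE_commutator hi hij hj) hg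
    (Kbar_sq hj') hB (hB.Kinv_left_one hj') ((qcommute_K_Kbar hi' hj').Kinv_left_one hi')
    (qcommute_K_K hi' hj') hKK (hKK.symm_one.Kinv_left_one hj').symm_one
    ((qcommute_K_K hj' hj').Kinv_left_one hj').symm_one hBs hKs

end Overlapping

end QuantumQueer

end

/-! ### The six cases -/

open QuantumQueer in
theorem mainTheorem7 (n i j k l : ℕ) (hi : 1 ≤ i) (hij : i < j) (hj : j ≤ n)
    (hkl : k < l) (hl : l ≤ n) (hik : i ≤ k) :
    ((j ≤ k ∨ (i < k ∧ l < j)) →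
      rootEbar n j i * rootEbar n k l = -(rootEbar n k l * rootEbar n j i)) ∧
    ((i = k ∧ j < l) →
      rootEbar n j i * rootEbar n k l =
        -(rootEbar n k l * rootEbar n j i)
          - Kbar n j * rootEbar n j l * Kinv n i
          - v⁻¹ • (rootEbar n j l * Kbar n j * Kinv n i)) ∧
    ((i = k ∧ l < j) →
      rootEbar n j i * rootEbar n k l =
        -(rootEbar n k l * rootEbar n j i)
          - rootEbar n j l * Kbar n l * K n i
          - v • (Kbar n l * rootEbar n j l * K n i)) ∧
    ((i < k ∧ j = l) →
      rootEbar n j i * rootEbar n k l =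
        -(rootEbar n k l * rootEbar n j i)
          - rootE n k i * Kinv n k * Kinv n j
          - (v - v⁻¹) • ((rootE n j i * rootEbar n k j - rootEbar n k j * rootE n j i)
              * Kinv n j * Kbar n j)) ∧
    ((i < k ∧ k < j ∧ j < l) →
      rootEbar n j i * rootEbar n k l =
        -(rootEbar n k l * rootEbar n j i)
          - (v - v⁻¹) • (Kbar n j * rootEbar n j l * rootE n k i * Kinv n k)
          - (v⁻¹ * (v - v⁻¹)) • (rootE n k i * rootEbar n j l * Kbar n j * Kinv n k)) ∧
    ((i = k ∧ j = l) →
      rootEbar n j i * rootEbar n k l =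
        -(rootEbar n k l * rootEbar n j i)
          + (v - v⁻¹)⁻¹ • (K n j * K n i - Kinv n i * Kinv n j)
          + (v - v⁻¹) • (Kbar n j ^ 2 * Kinv n i * K n j)
          - (v - v⁻¹) • ((rootEbar n j i * rootE n i j - rootE n i j * rootEbar n j i)
              * K n j * Kbar n j)) := by
  refine ⟨?_, ?_, ?_, ?_, ?_, ?_⟩
  · rintro (h | ⟨h, h'⟩)
    · exact (qcommute_rootEbar_neg_rootEbar_pos hi hij hj (by omega) hkl hl (.inl h)).anti
    · exact (qcommute_rootEbar_nested hi h hkl h' hj).anti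
  · rintro ⟨rfl, h⟩
    exact rootEbar_mul_same_left hi hij h hl
  · rintro ⟨rfl, h⟩
    exact rootEbar_mul_same_left_gt hi hkl h hj
  · rintro ⟨h, rfl⟩
    exact rootEbar_mul_same_right hi h hkl hj
  · rintro ⟨h, h', h''⟩
    exact rootEbar_mul_crossing hi h h' h'' hl
  · rintro ⟨rfl, rfl⟩
    exact rootEbar_mul_opposite hi hij hj
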